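/- Fix an acceptable numbering $\varphi_0,\varphi_1,\dots$ of the partial recursive functions, and let $W_e$ be the domain of $\varphi_e$. Let $\eta$ be a positive (that is, recursively enumerable) equivalence relation on $\mathbb N$ with infinitely many equivalence classes, and write $[D]$ for the union of the $\eta$-classes of the elements of $D\subseteq\mathbb N$. A set is $\eta$-infinite if it is the union of infinitely many $\eta$-classes. An $\eta$-family is a family $\{B_0,B_1,\dots\}$ of pairwise distinct sets, each a union of $\eta$-classes, such that $\{(k,x): x\in B_k\}$ is r.e. A text for $L\subseteq\mathbb N$ is a map $T:\mathbb N\to\mathbb N\cup\{\#\}$ whose range without $\#$ is $L$; $T[n]$ is the sequence $T(0),\dots,T(n-1)$. A learner is a (total) recursive function $M$ from finite sequences over $\mathbb N\cup\{\#\}$ to $\mathbb N\cup\{?\}$. An output $e\in\mathbb N$ is correct for $L$ if $[W_e]=L$; the output $?$ is never correct. The learner $M$ learns a class $\mathcal C$ - explanatorily if for every $L\in\mathcal C$ and every text $T$ for $L$ there is an $n$ such that $M(T[n])$ is correct for $L$ and $M(T[j])=M(T[n])$ for all $j\ge n$; - behaviourally correctly if for every $L\in\mathcal C$ and every text $T$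 for $L$ there is an $n$ such that $M(T[j])$ is correct for $L$ for all $j\ge n$; - vacillatorily if it learns $\mathcal C$ behaviourally correctly and, for every $L\in\mathcal C$ and every text $T$ for $L$, the set $\{M(T[n]): n\ge 1\}$ is finite. A class is explanatorily (resp. vacillatorily, behaviourally correctly) learnable if some learner learns it in that sense. Behaviourally correct learning is closed under union with respect to $\eta$ if, for all behaviourally correctly learnable $\eta$-families $\mathcal L,\mathcal H$ such that $\mathcal L\cup\mathcal H$ is an $\eta$-family, $\mathcal L\cup\mathcal H$ is behaviourally correctly learnable. Theorem. For every such $\eta$: (a) There are disjoint, explanatorily (resp. vacillatorily) learnable $\eta$-families $\mathcal L_1$ and $\mathcal L_2$ for which $\mathcal L_1\cup\mathcal L_2$ is an $\eta$-family that is not explanatorily (resp. vacillatorily) learnable. (b) Behaviourally correct learning is closed under union with respect to $\eta$ if and only if $\mathbb N$ is the only $\eta$-infinite r.e. set. -/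

import Mathlib

namespace EtaLearning

/-- A numbering `φ` of partial recursive functions is acceptable if it is itself partial recursive
(in both arguments) and every numbering `ψ` of partial recursive functions translates into it by a
recursive function. In particular every partial recursive function is some `φ e`. -/
def IsAcceptable (φ : ℕ → ℕ →. ℕ) : Prop :=
  Partrec₂ φ ∧
    ∀ ψ : ℕ → ℕ →. ℕ, Partrec₂ ψ → ∃ c : ℕ → ℕ, Computable c ∧ ∀ e, ψ e = φ (c e)

/-- The `e`-th r.e. set `W_e`, the domain of `φ e`. -/
def W (φ : ℕ → ℕ →. ℕ) (e : ℕ) : Set ℕ := (φ e).Dom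

/-- A positive equivalence relation on `ℕ`: it is recursively enumerable as a set of pairs, and it
has infinitely many equivalence classes. -/
structure IsPositive (η : Setoid ℕ) : Prop where
  re : REPred fun p : ℕ × ℕ => η p.1 p.2
  infinite_classes : Infinite (Quotient η)

/-- The `η`-closure `[D]`, the union of the classes of the elements of `D`. -/
def etaClosure (η : Setoid ℕ) (D : Set ℕ) : Set ℕ := {y | ∃ x ∈ D, η x y}

/-- `A` is a union of `η`-equivalence classes. -/
def EtaClosed (η : Setoid ℕ) (A : Set ℕ) : Prop := ∀ x y : ℕ, η x y → x ∈ A → y ∈ A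

/-- `A` is a union of infinitely many `η`-equivalence classes. -/
def EtaInfinite (η : Setoid ℕ) (A : Set ℕ) : Prop :=
  EtaClosed η A ∧ ((Quotient.mk η) '' A).Infinite

/-- An `η`-family: a family with a uniformly r.e. one-one numbering `B 0, B 1, …` by sets that are
unions of `η`-equivalence classes. (Such a family is infinite since `B` is injective.) -/
def IsEtaFamily (η : Setoid ℕ) (C : Set (Set ℕ)) : Prop :=
  ∃ B : ℕ → Set ℕ, (REPred fun p : ℕ × ℕ => p.2 ∈ B p.1) ∧ Function.Injective B ∧
    Set.range B = C ∧ ∀ k, EtaClosed η (B k)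

/-- `T` is a text for `L`; the pause symbol `#` is `none`. -/
def IsText (T : ℕ → Option ℕ) (L : Set ℕ) : Prop := ∀ x : ℕ, x ∈ L ↔ ∃ n, T n = some x

/-- The initial segment `T[n] = T(0), …, T(n-1)`. -/
def seg (T : ℕ → Option ℕ) (n : ℕ) : List (Option ℕ) := (List.range n).map T

/-- A learner maps finite sequences over `ℕ ∪ {#}` to `ℕ ∪ {?}`; the symbol `?` is `none`. -/
abbrev Learner : Type := List (Option ℕ) → Option ℕ

/-- The output `h` of a learner is a correct hypothesis for `L`: it is a number `e` (not `?`) for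
which the `η`-closure of `W_e` is `L`. -/
def Correct (φ : ℕ → ℕ →. ℕ) (η : Setoid ℕ) (h : Option ℕ) (L : Set ℕ) : Prop :=
  ∃ e : ℕ, h = some e ∧ etaClosure η (W φ e) = L

/-- `M` explanatorily learns the class `C`. -/
def ExLearns (φ : ℕ → ℕ →. ℕ) (η : Setoid ℕ) (M : Learner) (C : Set (Set ℕ)) : Prop :=
  ∀ L ∈ C, ∀ T : ℕ → Option ℕ, IsText T L →
    ∃ n, Correct φ η (M (seg T n)) L ∧ ∀ j ≥ n, M (seg T j) = M (seg T n)

/-- `M` behaviourally correctly learns the class `C`. -/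
def BCLearns (φ : ℕ → ℕ →. ℕ) (η : Setoid ℕ) (M : Learner) (C : Set (Set ℕ)) : Prop :=
  ∀ L ∈ C, ∀ T : ℕ → Option ℕ, IsText T L → ∃ n, ∀ j ≥ n, Correct φ η (M (seg T j)) L

/-- `M` vacillatorily learns the class `C`. -/
def VacLearns (φ : ℕ → ℕ →. ℕ) (η : Setoid ℕ) (M : Learner) (C : Set (Set ℕ)) : Prop :=
  BCLearns φ η M C ∧ ∀ L ∈ C, ∀ T : ℕ → Option ℕ, IsText T L →
    {h : Option ℕ | ∃ n ≥ 1, h = M (seg T n)}.Finite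

/-- `C` is explanatorily learnable (by a recursive learner). -/
def ExLearnable (φ : ℕ → ℕ →. ℕ) (η : Setoid ℕ) (C : Set (Set ℕ)) : Prop :=
  ∃ M : Learner, Computable M ∧ ExLearns φ η M C

/-- `C` is vacillatorily learnable (by a recursive learner). -/
def VacLearnable (φ : ℕ → ℕ →. ℕ) (η : Setoid ℕ) (C : Set (Set ℕ)) : Prop :=
  ∃ M : Learner, Computable M ∧ VacLearns φ η M C

/-- `C` is behaviourally correctly learnable (by a recursive learner). -/
def BCLearnable (φ : ℕ → ℕ →. ℕ) (η : Setoid ℕ) (C : Set (Set ℕ)) : Prop :=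
  ∃ M : Learner, Computable M ∧ BCLearns φ η M C

/-- The learnability notion `I` is closed under union with respect to `η`. -/
def ClosedUnderUnion (η : Setoid ℕ) (I : Set (Set ℕ) → Prop) : Prop :=
  ∀ L H : Set (Set ℕ), IsEtaFamily η L → IsEtaFamily η H → IsEtaFamily η (L ∪ H) →
    I L → I H → I (L ∪ H)

end EtaLearning

namespace EtaLearning

/-! ### Closure properties of r.e. predicates -/

section REPred

variable {α β : Type*} [Primcodable α] [Primcodable β]

/-! Everything turns on whether some r.e. η-infinite set differs from ℕ. Explanatory learnability
implies vacillatory, which implies behaviourally correct, so in each case one pair of explanatorily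
learnable families settles both halves of (a).

Suppose A ≠ ℕ is such a set, and d ∉ A. One family consists of the unions of the first k+1 classes
in an enumeration of A; the other consists of A and of these unions enlarged by the class of d. Each
is learnable from the first missing term of a suitable sequence. Their union contains A and an
increasing chain exhausting A, so A has no telltale and the union is not even behaviourally
correctly learnable (`exists_exLearnable_not_bcLearnable_union`).

Suppose ℕ is the only such set. A behaviourally correctly learnable η-family then omits ℕ
(`univ_notMem_of_bcLearnable`), so its members are finite unions of classes; any collection of such
sets is learnt by conjecturing the closure of the data seen, which gives closure under union. For
(a), all sets [{0, y}] and [0] are distributed over two families, padded with chain members so that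
the numberings are one-one. A vacillatory learner of the union would make the set of y that force a
hypothesis outside a finite list r.e. and η-infinite, yet it omits 0
(`not_vacLearnable_of_zeroPair`). -/

theorem primrec_option_toList : Primrec (Option.toList : Option α → List α) :=
  (Primrec.option_casesOn Primrec.id (Primrec.const [])
    (Primrec.list_cons.comp Primrec.snd (Primrec.const [])).to₂).of_eq
    fun o => by cases o <;> rfl

theorem exists_primrecPred_of_re {p : α → Prop} (hp : REPred p) :
    ∃ v : α × ℕ → Prop, PrimrecPred v ∧ ∀ a, p a ↔ ∃ n, v (a, n) := by
  obtain ⟨c, hc⟩ := Nat.Partrec.Code.exists_code.1 hp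
  refine ⟨fun q => (Nat.Partrec.Code.evaln q.2 c (Encodable.encode q.1)).isSome = true, ?_, ?_⟩
  · have h : Primrec fun q : α × ℕ => Nat.Partrec.Code.evaln q.2 c (Encodable.encode q.1) :=
      Nat.Partrec.Code.primrec_evaln.comp
        ((Primrec.snd.pair (Primrec.const c)).pair (Primrec.encode.comp Primrec.fst))
    exact Primrec.primrecPred ((Primrec.option_isSome.comp h).of_eq fun q => by simp)
  · intro a
    have h2 : p a ↔ ∃ x, x ∈ Nat.Partrec.Code.eval c (Encodable.encode a) := by
      rw [hc]
      simp [Part.mem_assert_iff]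
    simp only [h2, Nat.Partrec.Code.evaln_complete, Option.isSome_iff_exists, Option.mem_def]
    exact exists_comm

theorem re_of_primrecPred {v : α × ℕ → Prop} (hv : PrimrecPred v) :
    REPred fun a => ∃ n, v (a, n) := by
  obtain ⟨hd, hv⟩ := hv
  have h : Partrec fun a => Nat.rfind fun n => Part.some (decide (v (a, n))) :=
    Partrec.rfind (hv.to_comp.partrec).to₂
  refine h.dom_re.of_eq fun a => ?_
  refine Nat.rfind_dom.trans ?_
  constructor
  · rintro ⟨n, hn, -⟩
    exact ⟨n, by simpa using hn⟩
  · rintro ⟨n, hn⟩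
    exact ⟨n, by simpa using hn, fun _ => trivial⟩

theorem re_of_primrecPred' {v : α → Prop} (hv : PrimrecPred v) : REPred v :=
  (re_of_primrecPred (v := fun q : α × ℕ => v q.1) (hv.comp Primrec.fst)).of_eq
    fun a => exists_const (b := v a) ℕ

theorem re_comp {p : β → Prop} (hp : REPred p) {f : α → β} (hf : Computable f) :
    REPred fun a => p (f a) :=
  Partrec.comp hp hf

theorem re_and {p q : α → Prop} (hp : REPred p) (hq : REPred q) :
    REPred fun a => p a ∧ q a := by
  obtain ⟨v, hv, h⟩ := exists_primrecPred_of_re hp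
  obtain ⟨w, hw, h'⟩ := exists_primrecPred_of_re hq
  refine (re_of_primrecPred (v := fun a : α × ℕ => v (a.1, a.2.unpair.1) ∧ w (a.1, a.2.unpair.2))
    (PrimrecPred.and (hv.comp ?_) (hw.comp ?_))).of_eq fun a => ?_
  · exact Primrec.fst.pair (Primrec.fst.comp (Primrec.unpair.comp Primrec.snd))
  · exact Primrec.fst.pair (Primrec.snd.comp (Primrec.unpair.comp Primrec.snd))
  · rw [h, h']
    constructor
    · rintro ⟨n, hn⟩
      exact ⟨⟨_, hn.1⟩, ⟨_, hn.2⟩⟩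
    · rintro ⟨⟨n, hn⟩, ⟨m, hm⟩⟩
      exact ⟨Nat.pair n m, by simpa using ⟨hn, hm⟩⟩

theorem re_or {p q : α → Prop} (hp : REPred p) (hq : REPred q) :
    REPred fun a => p a ∨ q a := by
  obtain ⟨v, hv, h⟩ := exists_primrecPred_of_re hp
  obtain ⟨w, hw, h'⟩ := exists_primrecPred_of_re hq
  refine (re_of_primrecPred (hv.or hw)).of_eq fun a => ?_
  rw [h, h', exists_or]

theorem re_exists {p : α × β → Prop} (hp : REPred p) : REPred fun a => ∃ b, p (a, b) := by
  obtain ⟨v, hv, h⟩ := exists_primrecPred_of_re hp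
  have key : PrimrecPred fun a : α × ℕ =>
      ∃ b ∈ (Encodable.decode (α := β) a.2.unpair.1).toList, v ((a.1, b), a.2.unpair.2) := by
    have : PrimrecRel fun (b : β) (a : α × ℕ) => v ((a.1, b), a.2.unpair.2) :=
      hv.comp (((Primrec.fst.comp Primrec.snd).pair Primrec.fst).pair
        (Primrec.snd.comp (Primrec.unpair.comp (Primrec.snd.comp Primrec.snd))))
    refine (PrimrecRel.exists_mem_list this).comp ?_ Primrec.id
    exact primrec_option_toList.comp (Primrec.decode.comp
      (Primrec.fst.comp (Primrec.unpair.comp Primrec.snd)))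
  refine (re_of_primrecPred key).of_eq fun a => ?_
  constructor
  · rintro ⟨n, b, -, hb⟩
    exact ⟨b, (h _).2 ⟨_, hb⟩⟩
  · rintro ⟨b, hb⟩
    obtain ⟨n, hn⟩ := (h _).1 hb
    exact ⟨Nat.pair (Encodable.encode b) n, b, by simp, by simpa using hn⟩

theorem re_forall_mem {p : β × α → Prop} (hp : REPred p) {l : α → List β} (hl : Computable l) :
    REPred fun a => ∀ b ∈ l a, p (b, a) := by
  obtain ⟨v, hv, h⟩ := exists_primrecPred_of_re hp
  have h1 : PrimrecRel fun (n : ℕ) (q : β × α) => ∃ m < n, v (q, m) :=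
    ((PrimrecRel.exists_mem_list (R := fun (m : ℕ) (q : β × α) => v (q, m))
      (hv.comp (Primrec.snd.pair Primrec.fst))).comp (Primrec.list_range.comp Primrec.fst)
        Primrec.snd).of_eq fun _ => by simp
  have h2 : PrimrecRel fun (b : β) (q : α × ℕ) => ∃ m < q.2, v ((b, q.1), m) :=
    h1.comp (Primrec.snd.comp Primrec.snd) (Primrec.fst.pair (Primrec.fst.comp Primrec.snd))
  have h3 : PrimrecPred fun q : (List β × α) × ℕ => ∀ b ∈ q.1.1, ∃ m < q.2, v ((b, q.1.2), m) :=
    (PrimrecRel.forall_mem_list h2).comp (Primrec.fst.comp Primrec.fst)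
      ((Primrec.snd.comp Primrec.fst).pair Primrec.snd)
  refine ((re_comp (re_of_primrecPred h3) (hl.pair Computable.id))).of_eq fun a => ?_
  constructor
  · rintro ⟨n, hn⟩ b hb
    obtain ⟨m, -, hm⟩ := hn b hb
    exact (h _).2 ⟨m, hm⟩
  · intro H
    choose! f hf using fun b hb => (h _).1 (H b hb)
    -- A finite list has a common bound for its witnesses, so a single search over stages suffices.
    obtain ⟨N, hN⟩ : ∃ N, ∀ b ∈ l a, f b < N := by
      generalize l a = L
      clear hf H
      induction L with
      | nil => exact ⟨0, by simp⟩
      | cons c L ih =>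
        obtain ⟨N, hN⟩ := ih
        refine ⟨max N (f c + 1), fun b hb => ?_⟩
        rcases List.mem_cons.1 hb with rfl | hb
        · simp
        · exact lt_max_of_lt_left (hN b hb)
    exact ⟨N, fun b hb => ⟨f b, hN b hb, hf b hb⟩⟩

theorem re_exists_mem {p : β × α → Prop} (hp : REPred p) {l : α → List β} (hl : Computable l) :
    REPred fun a => ∃ b ∈ l a, p (b, a) := by
  classical
  refine (re_exists (p := fun q : α × β => q.2 ∈ l q.1 ∧ p (q.2, q.1)) (re_and ?_ ?_)).of_eq
    fun a => Iff.rfl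
  · have : PrimrecPred fun q : List β × β => ∃ c ∈ q.1, c = q.2 :=
      PrimrecRel.exists_mem_list (R := fun c b : β => c = b) Primrec.eq
    refine (re_comp (re_of_primrecPred' this)
      ((hl.comp Computable.fst).pair Computable.snd)).of_eq fun q => by simp
  · exact re_comp hp (Computable.snd.pair Computable.fst)

theorem re_of_computable_bool {f : α → Bool} (hf : Computable f) : REPred fun a => f a = true :=
  (ComputablePred.to_re ⟨inferInstance, hf.of_eq fun a => by simp⟩)

theorem exists_computable_range {A : Set ℕ} (hA : REPred fun x : ℕ => x ∈ A) (hne : A.Nonempty) :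
    ∃ e : ℕ → ℕ, Computable e ∧ Set.range e = A := by
  classical
  obtain ⟨v, hv, h⟩ := exists_primrecPred_of_re hA
  obtain ⟨a, ha⟩ := hne
  have hv' : PrimrecPred fun n : ℕ => v n.unpair := hv.comp Primrec.unpair
  refine ⟨fun n => if v n.unpair then n.unpair.1 else a,
    (Primrec.ite hv' (Primrec.fst.comp Primrec.unpair) (Primrec.const a)).to_comp, ?_⟩
  ext x
  constructor
  · rintro ⟨n, rfl⟩
    dsimp only
    split_ifs with hn
    · exact (h _).2 ⟨_, hn⟩
    · exact ha
  · intro hx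
    obtain ⟨n, hn⟩ := (h x).1 hx
    exact ⟨Nat.pair x n, by simp [hn]⟩

end REPred

/-! ### Unions of η-classes -/

section Closure

variable {η : Setoid ℕ}

theorem subset_etaClosure (D : Set ℕ) : D ⊆ etaClosure η D := fun x hx => ⟨x, hx, η.refl x⟩

theorem EtaClosed.etaClosure_subset {A D : Set ℕ} (hA : EtaClosed η A) (h : D ⊆ A) :
    etaClosure η D ⊆ A := by
  rintro y ⟨x, hx, hxy⟩
  exact hA x y hxy (h hx)

theorem EtaClosed.etaClosure_eq {A : Set ℕ} (hA : EtaClosed η A) : etaClosure η A = A :=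
  (hA.etaClosure_subset subset_rfl).antisymm (subset_etaClosure A)

theorem EtaClosed.union {A B : Set ℕ} (hA : EtaClosed η A) (hB : EtaClosed η B) :
    EtaClosed η (A ∪ B) := by
  rintro x y hxy (h | h)
  exacts [Or.inl (hA x y hxy h), Or.inr (hB x y hxy h)]

theorem EtaClosed.mem_of_mk_mem {A : Set ℕ} (hA : EtaClosed η A) {x : ℕ}
    (h : Quotient.mk η x ∈ Quotient.mk η '' A) : x ∈ A := by
  obtain ⟨y, hy, hyx⟩ := h
  exact hA y x (Quotient.exact hyx) hy

theorem EtaClosed.eq_of_image_eq {A B : Set ℕ} (hA : EtaClosed η A) (hB : EtaClosed η B)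
    (h : Quotient.mk η '' A = Quotient.mk η '' B) : A = B := by
  ext x
  exact ⟨fun hx => hB.mem_of_mk_mem (h ▸ Set.mem_image_of_mem _ hx),
    fun hx => hA.mem_of_mk_mem (h ▸ Set.mem_image_of_mem _ hx)⟩

theorem image_mk_etaClosure (D : Set ℕ) :
    Quotient.mk η '' etaClosure η D = Quotient.mk η '' D := by
  apply Set.Subset.antisymm
  · rintro _ ⟨y, ⟨x, hx, hxy⟩, rfl⟩
    exact ⟨x, hx, Quotient.sound hxy⟩
  · exact Set.image_mono (subset_etaClosure D)

theorem etaClosed_univ : EtaClosed η Set.univ := fun _ _ _ _ => trivial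

theorem etaInfinite_univ (hη : IsPositive η) : EtaInfinite η Set.univ := by
  refine ⟨etaClosed_univ, ?_⟩
  have := hη.infinite_classes
  rw [Set.image_univ, Set.range_eq_univ.2 Quotient.mk_surjective]
  exact Set.infinite_univ

theorem not_etaInfinite_iff {A : Set ℕ} (hA : EtaClosed η A) :
    ¬ EtaInfinite η A ↔ (Quotient.mk η '' A).Finite := by
  simp [EtaInfinite, hA]

end Closure

/-! ### Initial unions of classes in an enumeration -/

section Chain

/-- The union of the first `k + 1` distinct `η`-classes occurring in the sequence `e`. -/
def chain (η : Setoid ℕ) (e : ℕ → ℕ) (k : ℕ) : Set ℕ :=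
  {x | ∃ z, η x (e z) ∧ (Quotient.mk η '' (e '' Set.Iic z)).ncard ≤ k + 1}

variable {η : Setoid ℕ} {e : ℕ → ℕ}

theorem etaClosed_chain (k : ℕ) : EtaClosed η (chain η e k) := by
  rintro x y hxy ⟨z, hz, h⟩
  exact ⟨z, η.trans (η.symm hxy) hz, h⟩

theorem mem_chain {z k : ℕ} (h : z ≤ k) : e z ∈ chain η e k := by
  refine ⟨z, η.refl _, ?_⟩
  calc _ ≤ (e '' Set.Iic z).ncard := Set.ncard_image_le ((Set.finite_Iic z).image e)
    _ ≤ (Set.Iic z).ncard := Set.ncard_image_le (Set.finite_Iic z)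
    _ = z + 1 := by rw [Set.ncard_eq_toFinset_card']; simp
    _ ≤ k + 1 := by omega

theorem chain_subset {A : Set ℕ} (hA : EtaClosed η A) (he : ∀ n, e n ∈ A) (k : ℕ) :
    chain η e k ⊆ A := by
  rintro x ⟨z, hz, -⟩
  exact hA _ _ (η.symm hz) (he z)

/-- Counting classes from above is a positive condition: a short list of representatives witnesses
it. This makes `chain` uniformly r.e. although η need not be decidable. -/
theorem ncard_classes_le_iff {D : Set ℕ} (hD : D.Finite) (k : ℕ) :
    (Quotient.mk η '' D).ncard ≤ k ↔ ∃ l : List ℕ, l.length ≤ k ∧ ∀ x ∈ D, ∃ w ∈ l, η x w := by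
  classical
  constructor
  · intro h
    have hfin : (Quotient.mk η '' D).Finite := hD.image _
    refine ⟨hfin.toFinset.toList.map Quotient.out, ?_, fun x hx => ?_⟩
    · rw [Set.ncard_eq_toFinset_card _ hfin] at h
      simpa using h
    · refine ⟨(Quotient.mk η x).out, List.mem_map.2 ⟨_, ?_, rfl⟩, ?_⟩
      · simpa using ⟨x, hx, rfl⟩
      · exact η.symm (Quotient.mk_out x)
  · rintro ⟨l, hl, h⟩
    have hsub : Quotient.mk η '' D ⊆ ((l.map (Quotient.mk η)).toFinset : Set (Quotient η)) := by
      rintro _ ⟨x, hx, rfl⟩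
      obtain ⟨w, hw, hxw⟩ := h x hx
      simp only [List.coe_toFinset, List.mem_map, Set.mem_ofPred_eq]
      exact ⟨w, hw, (Quotient.sound hxw).symm⟩
    refine (Set.ncard_le_ncard hsub (Finset.finite_toSet _)).trans ?_
    rw [Set.ncard_coe_finset]
    exact (List.toFinset_card_le _).trans (by simpa using hl)

theorem re_eta (hη : IsPositive η) {α : Type*} [Primcodable α] {f g : α → ℕ}
    (hf : Computable f) (hg : Computable g) : REPred fun a => η (f a) (g a) :=
  re_comp (p := fun p : ℕ × ℕ => η p.1 p.2) hη.re (f := fun a => (f a, g a)) (hf.pair hg)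

theorem re_ncard_le (hη : IsPositive η) (he : Computable e) :
    REPred fun p : ℕ × ℕ => (Quotient.mk η '' (e '' Set.Iic p.1)).ncard ≤ p.2 := by
  have h1 : REPred fun q : ℕ × List ℕ => ∃ w ∈ q.2, η (e q.1) w :=
    re_exists_mem (p := fun r : ℕ × (ℕ × List ℕ) => η (e r.2.1) r.1) (l := Prod.snd)
      (re_eta hη (f := fun r : ℕ × (ℕ × List ℕ) => e r.2.1)
        (he.comp (Computable.fst.comp Computable.snd)) Computable.fst) Computable.snd
  have h2 : REPred fun q : (ℕ × ℕ) × List ℕ =>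
      ∀ i ∈ List.range (q.1.1 + 1), ∃ w ∈ q.2, η (e i) w :=
    re_forall_mem (p := fun r : ℕ × ((ℕ × ℕ) × List ℕ) => ∃ w ∈ r.2.2, η (e r.1) w)
      (re_comp (f := fun r : ℕ × ((ℕ × ℕ) × List ℕ) => (r.1, r.2.2)) h1
        (Computable.fst.pair (Computable.snd.comp Computable.snd)))
      (l := fun q : (ℕ × ℕ) × List ℕ => List.range (q.1.1 + 1))
      (Primrec.list_range.comp
        (Primrec.succ.comp (Primrec.fst.comp Primrec.fst))).to_comp
  have h3 : REPred fun q : (ℕ × ℕ) × List ℕ => q.2.length ≤ q.1.2 :=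
    re_of_primrecPred' (Primrec.nat_le.comp (Primrec.list_length.comp Primrec.snd)
      (Primrec.snd.comp Primrec.fst))
  refine (re_exists (re_and h3 h2)).of_eq fun p => ?_
  rw [ncard_classes_le_iff ((Set.finite_Iic _).image e)]
  refine exists_congr fun l => and_congr_right fun _ => ?_
  simp

theorem re_chain (hη : IsPositive η) (he : Computable e) :
    REPred fun p : ℕ × ℕ => p.2 ∈ chain η e p.1 := by
  refine re_exists (p := fun q : (ℕ × ℕ) × ℕ => η q.1.2 (e q.2) ∧
    (Quotient.mk η '' (e '' Set.Iic q.2)).ncard ≤ q.1.1 + 1) (re_and ?_ ?_)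
  · exact re_eta hη (f := fun q : (ℕ × ℕ) × ℕ => q.1.2) (g := fun q => e q.2)
      (Computable.snd.comp Computable.fst) (he.comp Computable.snd)
  · exact re_comp (f := fun q : (ℕ × ℕ) × ℕ => (q.2, q.1.1 + 1)) (re_ncard_le hη he) (Computable.snd.pair
      (Computable.succ.comp (Computable.fst.comp Computable.fst)))

/-- The number `g z` of classes among the first terms starts at 1, grows by at most 1 per step and
is unbounded. It therefore takes the value k + 1, and the term that next raises it is the first one
outside the chain member. -/
theorem exists_chain_eq (hinf : (Quotient.mk η '' Set.range e).Infinite) (k : ℕ) :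
    ∃ n, chain η e k = etaClosure η (e '' Set.Iio n) ∧ e n ∉ chain η e k ∧
      (∀ i < n, e i ∈ chain η e k) ∧ (Quotient.mk η '' chain η e k).ncard = k + 1 := by
  set g : ℕ → ℕ := fun z => (Quotient.mk η '' (e '' Set.Iic z)).ncard with hg
  have hfin : ∀ z, (Quotient.mk η '' (e '' Set.Iic z)).Finite := fun z =>
    ((Set.finite_Iic z).image e).image _
  have hmono : Monotone g := fun a b hab => Set.ncard_le_ncard
    (Set.image_mono (Set.image_mono (Set.Iic_subset_Iic.2 hab))) (hfin b)
  have hins : ∀ z, Quotient.mk η '' (e '' Set.Iic (z + 1)) =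
      insert (Quotient.mk η (e (z + 1))) (Quotient.mk η '' (e '' Set.Iic z)) := by
    intro z
    rw [← Set.image_insert_eq, ← Set.image_insert_eq]
    congr 2
    ext i
    simp only [Set.mem_Iic, Set.mem_insert_iff]
    omega
  -- Preimages of k + 2 distinct classes lie below some index z.
  have hunb : ∃ z, k + 1 < g z := by
    by_contra! hcon
    obtain ⟨t, ht, htc⟩ := hinf.exists_subset_ncard_eq (k + 2)
    have htf : t.Finite := Set.finite_of_ncard_ne_zero (by omega)
    rw [← Set.range_comp] at ht
    obtain ⟨s, rfl⟩ := Set.subset_range_iff_exists_image_eq.1 ht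
    obtain ⟨s', -, hbij⟩ := Set.exists_subset_bijOn s (Quotient.mk η ∘ e)
    have himg := hbij.image_eq
    have hsf : s'.Finite := hbij.finite_iff_finite.2 htf
    obtain ⟨z, hz⟩ := hsf.bddAbove
    have hsub : (Quotient.mk η ∘ e) '' s ⊆ Quotient.mk η '' (e '' Set.Iic z) := by
      rw [← himg, Set.image_comp]
      exact Set.image_mono (Set.image_mono hz)
    have := (Set.ncard_le_ncard hsub (hfin z)).trans (hcon z)
    omega
  have h0 : g 0 ≤ k + 1 := by
    have : g 0 = 1 := by
      have : (Set.Iic 0 : Set ℕ) = {0} := by ext; simp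
      simp [hg, this]
    omega
  classical
  obtain ⟨z, hz, hz'⟩ : ∃ z, g z ≤ k + 1 ∧ k + 1 < g (z + 1) := by
    by_contra! hcon
    obtain ⟨z, hz⟩ := hunb
    have : ∀ z, g z ≤ k + 1 := fun z => by
      induction z with
      | zero => exact h0
      | succ z ih => exact hcon z ih
    exact absurd (this z) (by omega)
  have hle : g (z + 1) ≤ g z + 1 := by
    simp only [hg, hins]
    exact Set.ncard_insert_le _ _
  have heq : chain η e k = etaClosure η (e '' Set.Iio (z + 1)) := by
    have hI : Set.Iio (z + 1) = Set.Iic z := by ext; simp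
    rw [hI]
    apply Set.Subset.antisymm
    · rintro x ⟨w, hxw, hw⟩
      refine ⟨e w, ⟨w, ?_, rfl⟩, η.symm hxw⟩
      by_contra hwz
      have : g (z + 1) ≤ g w := hmono (by simp only [Set.mem_Iic] at hwz; omega)
      change g w ≤ k + 1 at hw
      omega
    · refine (etaClosed_chain k).etaClosure_subset ?_
      rintro _ ⟨i, hi, rfl⟩
      exact ⟨i, η.refl _, (hmono hi).trans hz⟩
  have hI : Set.Iio (z + 1) = Set.Iic z := by ext; simp
  refine ⟨z + 1, heq, ?_, fun i hi => ?_, ?_⟩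
  · intro hmem
    rw [heq, hI] at hmem
    have : Quotient.mk η (e (z + 1)) ∈ Quotient.mk η '' (e '' Set.Iic z) := by
      rw [← image_mk_etaClosure]
      exact Set.mem_image_of_mem _ hmem
    have : g (z + 1) = g z := by
      simp only [hg, hins, Set.insert_eq_of_mem this]
    omega
  · rw [heq]
    exact subset_etaClosure _ ⟨i, hi, rfl⟩
  · rw [heq, image_mk_etaClosure, hI]
    change g z = k + 1
    omega

theorem chain_injective (hinf : (Quotient.mk η '' Set.range e).Infinite) :
    Function.Injective (chain η e) := by
  intro k l h
  obtain ⟨-, -, -, -, hk⟩ := exists_chain_eq hinf k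
  obtain ⟨-, -, -, -, hl⟩ := exists_chain_eq hinf l
  rw [h] at hk
  omega

theorem finite_chain (k : ℕ) (hinf : (Quotient.mk η '' Set.range e).Infinite) :
    (Quotient.mk η '' chain η e k).Finite := by
  obtain ⟨-, -, -, -, hk⟩ := exists_chain_eq hinf k
  exact Set.finite_of_ncard_ne_zero (by omega)

end Chain

/-! ### Disjoint unions of families -/

section Families

variable {η : Setoid ℕ}

/-- Even indices number one family and odd indices the other; disjointness keeps the merged
numbering one-one. -/
theorem IsEtaFamily.union {L H : Set (Set ℕ)} (hL : IsEtaFamily η L) (hH : IsEtaFamily η H)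
    (hd : Disjoint L H) : IsEtaFamily η (L ∪ H) := by
  obtain ⟨B, hB, hBi, rfl, hBc⟩ := hL
  obtain ⟨C, hC, hCi, rfl, hCc⟩ := hH
  have hne : ∀ i j, B i ≠ C j := fun i j h =>
    Set.disjoint_left.1 hd ⟨i, rfl⟩ (h ▸ ⟨j, rfl⟩)
  refine ⟨fun k => if k % 2 = 0 then B (k / 2) else C (k / 2), ?_, ?_, ?_, ?_⟩
  · have hdiv : Computable fun p : ℕ × ℕ => (p.1 / 2, p.2) :=
      ((Primrec.nat_div.comp Primrec.fst (Primrec.const 2)).pair Primrec.snd).to_comp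
    have hm : PrimrecPred fun p : ℕ × ℕ => p.1 % 2 = 0 :=
      Primrec.eq.comp (Primrec.nat_mod.comp Primrec.fst (Primrec.const 2)) (Primrec.const 0)
    refine (re_or (re_and (re_of_primrecPred' hm) (re_comp hB hdiv))
      (re_and (re_of_primrecPred' hm.not) (re_comp hC hdiv))).of_eq fun p => ?_
    by_cases h : p.1 % 2 = 0 <;> simp [h]
  · intro i j hij
    dsimp only at hij
    split_ifs at hij with h1 h2 h2
    · have := hBi hij
      omega
    · exact absurd hij (hne _ _)
    · exact absurd hij.symm (hne _ _)
    · have := hCi hij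
      omega
  · ext A
    constructor
    · rintro ⟨k, rfl⟩
      dsimp only
      split_ifs
      exacts [Or.inl ⟨_, rfl⟩, Or.inr ⟨_, rfl⟩]
    · rintro (⟨k, rfl⟩ | ⟨k, rfl⟩)
      · exact ⟨2 * k, by simp⟩
      · refine ⟨2 * k + 1, ?_⟩
        have h1 : (2 * k + 1) % 2 ≠ 0 := by omega
        have h2 : (2 * k + 1) / 2 = k := by omega
        simp only [h1, h2, if_false]
  · intro k
    dsimp only
    split_ifs
    exacts [hBc _, hCc _]

end Families

/-! ### Texts, locking sequences and telltales -/

section Texts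

/-- All numbers occurring in the sequence `σ` belong to `L`. -/
def Over (σ : List (Option ℕ)) (L : Set ℕ) : Prop := ∀ x, some x ∈ σ → x ∈ L

@[simp] theorem length_seg (T : ℕ → Option ℕ) (n : ℕ) : (seg T n).length = n := by simp [seg]

theorem getElem?_seg {T : ℕ → Option ℕ} {n i : ℕ} (h : i < n) : (seg T n)[i]? = some (T i) := by
  simp [seg, h]

theorem take_seg (T : ℕ → Option ℕ) {i n : ℕ} (h : i ≤ n) : (seg T n).take i = seg T i := by
  simp [seg, ← List.map_take, List.take_range, h]

theorem seg_add (T : ℕ → Option ℕ) (m k : ℕ) :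
    seg T (m + k) = seg T m ++ seg (fun i => T (m + i)) k := by
  simp [seg, List.range_add, Function.comp_def]

theorem mem_seg {T : ℕ → Option ℕ} {n : ℕ} {o : Option ℕ} :
    o ∈ seg T n ↔ ∃ i < n, T i = o := by
  simp [seg]

theorem Over.mono {σ : List (Option ℕ)} {L H : Set ℕ} (h : Over σ L) (hLH : L ⊆ H) : Over σ H :=
  fun x hx => hLH (h x hx)

theorem Over.append {σ τ : List (Option ℕ)} {L : Set ℕ} (h : Over σ L) (h' : Over τ L) :
    Over (σ ++ τ) L := by
  intro x hx
  rcases List.mem_append.1 hx with hx | hx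
  exacts [h x hx, h' x hx]

theorem exists_isText (L : Set ℕ) : ∃ T, IsText T L := by
  classical
  refine ⟨fun n => if n ∈ L then some n else none, fun x => ⟨fun hx => ⟨x, by simp [hx]⟩, ?_⟩⟩
  rintro ⟨n, hn⟩
  dsimp only at hn
  split_ifs at hn with h
  cases hn
  exact h

/-- A sequence over `L` extends to a text for `L`. -/
theorem exists_isText_extending {σ : List (Option ℕ)} {L : Set ℕ} (h : Over σ L) :
    ∃ T, IsText T L ∧ ∀ n, ∃ τ, Over τ L ∧ seg T (σ.length + n) = σ ++ τ := by
  obtain ⟨T, hT⟩ := exists_isText L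
  have hlt : ∀ i < σ.length, ∃ o ∈ σ, (if i < σ.length then σ[i]?.join else T (i - σ.length)) = o ∧
      σ[i]? = some o := by
    intro i hi
    exact ⟨σ[i], List.getElem_mem hi, by simp [hi], by simp [hi]⟩
  refine ⟨fun i => if i < σ.length then σ[i]?.join else T (i - σ.length), fun x => ⟨fun hx => ?_,
    ?_⟩, fun n => ⟨seg T n, fun x hx => ?_, ?_⟩⟩
  · obtain ⟨n, hn⟩ := (hT x).1 hx
    exact ⟨σ.length + n, by simp [hn]⟩
  · rintro ⟨n, hn⟩
    by_cases h' : n < σ.length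
    · obtain ⟨o, ho, ho', -⟩ := hlt n h'
      exact h x (by rw [← hn]; dsimp only; rw [ho']; exact ho)
    · exact (hT x).2 ⟨n - σ.length, by simpa [h'] using hn⟩
  · obtain ⟨i, -, hi⟩ := mem_seg.1 hx
    exact (hT x).2 ⟨i, hi⟩
  · rw [seg_add]
    congr 1
    · refine List.ext_getElem? fun i => ?_
      by_cases hi : i < σ.length
      · rw [getElem?_seg hi]
        obtain ⟨o, -, ho, ho'⟩ := hlt i hi
        rw [ho, ho']
      · rw [List.getElem?_eq_none (by simpa using hi), List.getElem?_eq_none (by simpa using hi)]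
    · simp

/-- If along every text for `L` the relation `Q` eventually fails between initial segments, then
some sequence over `L` is locking for the failure of `Q`. -/
theorem exists_locking (L : Set ℕ) (Q : List (Option ℕ) → List (Option ℕ) → Prop)
    (h : ∀ T, IsText T L → ∃ n, ∀ m ≥ n, ∀ j ≥ m, ¬ Q (seg T m) (seg T j)) :
    ∃ σ, Over σ L ∧ ∀ τ, Over τ L → ¬ Q σ (σ ++ τ) := by
  by_contra! hcon
  choose! f hf hQ using hcon
  obtain ⟨U, hU⟩ := exists_isText L
  -- If every sequence over L has a bad extension, alternating bad extensions with the terms of a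
  -- text U for L produces a text on which Q holds infinitely often.
  let S : ℕ → List (Option ℕ) := fun n => Nat.rec [] (fun n s => s ++ f s ++ [U n]) n
  have hS : ∀ n, S (n + 1) = S n ++ f (S n) ++ [U n] := fun n => rfl
  have hover : ∀ n, Over (S n) L := by
    intro n
    induction n with
    | zero => intro x hx; cases hx
    | succ n ih =>
      rw [hS]
      refine (ih.append (hf _ ih)).append fun x hx => (hU x).2 ⟨n, ?_⟩
      exact (List.mem_singleton.1 hx).symm
  have hpre : ∀ m n, m ≤ n → S m <+: S n := by
    intro m n hmn
    induction hmn with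
    | refl => exact List.prefix_rfl
    | step _ ih => exact ih.trans (by rw [hS, List.append_assoc]; exact List.prefix_append _ _)
  have hlen : ∀ n, n ≤ (S n).length := by
    intro n
    induction n with
    | zero => exact Nat.zero_le _
    | succ n ih => rw [hS]; simp; omega
  -- `S (i + 1)` has length at least i + 1, so the default hidden in `join` is never used.
  let T : ℕ → Option ℕ := fun i => ((S (i + 1))[i]?).join
  have hget : ∀ n i, i < (S n).length → (S n)[i]? = some (T i) := by
    intro n i hi
    have h1 : i < (S (i + 1)).length := hlen (i + 1)
    have h2 : (S n)[i]? = (S (i + 1))[i]? := by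
      rcases le_total n (i + 1) with hle | hle
      · rw [List.prefix_iff_getElem?.1 (hpre _ _ hle) i hi, List.getElem?_eq_getElem hi]
      · rw [List.prefix_iff_getElem?.1 (hpre _ _ hle) i h1, List.getElem?_eq_getElem h1]
    rw [h2]
    simp [T, List.getElem?_eq_getElem h1]
  have hseg : ∀ n ρ, ρ <+: S n → seg T ρ.length = ρ := by
    intro n ρ hρ
    refine List.ext_getElem? fun i => ?_
    by_cases hi : i < ρ.length
    · rw [getElem?_seg hi, ← hget n i (hi.trans_le hρ.length_le),
        List.prefix_iff_getElem?.1 hρ i hi, List.getElem?_eq_getElem hi]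
    · rw [List.getElem?_eq_none (by simpa using hi), List.getElem?_eq_none (by simpa using hi)]
  have hT : IsText T L := by
    intro x
    constructor
    · intro hx
      obtain ⟨n, hn⟩ := (hU x).1 hx
      have : some x ∈ S (n + 1) := by rw [hS, hn]; simp
      obtain ⟨i, hi, hix⟩ := List.mem_iff_getElem.1 this
      refine ⟨i, ?_⟩
      have := hget (n + 1) i hi
      rw [List.getElem?_eq_getElem hi, hix] at this
      exact (Option.some.inj this).symm
    · rintro ⟨i, hi⟩
      refine hover (i + 1) x ?_
      have := hget (i + 1) i (hlen (i + 1))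
      rw [hi] at this
      exact List.mem_of_getElem? this
  obtain ⟨n, hn⟩ := h T hT
  have h1 := hseg (n + 1) (S n ++ f (S n)) (by rw [hS]; exact List.prefix_append _ _)
  have h2 := hseg n (S n) List.prefix_rfl
  refine hn (S n).length (hlen n) (S n ++ f (S n)).length (by simp) ?_
  rw [h1, h2]
  exact hQ _ (hover n)

theorem exists_bc_locking {φ : ℕ → ℕ →. ℕ} {η : Setoid ℕ} {M : Learner} {C : Set (Set ℕ)}
    (hM : BCLearns φ η M C) {L : Set ℕ} (hL : L ∈ C) :
    ∃ σ, Over σ L ∧ ∀ τ, Over τ L → Correct φ η (M (σ ++ τ)) L := by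
  obtain ⟨σ, hσ, h⟩ := exists_locking L (fun _ ρ => ¬ Correct φ η (M ρ) L) fun T hT => by
    obtain ⟨n, hn⟩ := hM L hL T hT
    exact ⟨n, fun m hm j hj => not_not.2 (hn j (hm.trans hj))⟩
  exact ⟨σ, hσ, fun τ hτ => not_not.1 (h τ hτ)⟩

theorem Correct.unique {φ : ℕ → ℕ →. ℕ} {η : Setoid ℕ} {h : Option ℕ} {L H : Set ℕ}
    (hL : Correct φ η h L) (hH : Correct φ η h H) : L = H := by
  obtain ⟨e, rfl, rfl⟩ := hL
  obtain ⟨e', he, rfl⟩ := hH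
  cases he
  rfl

/-- Every set that is behaviourally correctly learnt within a class has a finite subset that is
contained in no proper subset in the class. -/
theorem exists_telltale {φ : ℕ → ℕ →. ℕ} {η : Setoid ℕ} {M : Learner} {C : Set (Set ℕ)}
    (hM : BCLearns φ η M C) {L : Set ℕ} (hL : L ∈ C) :
    ∃ D : Finset ℕ, ↑D ⊆ L ∧ ∀ H ∈ C, ↑D ⊆ H → H ⊆ L → H = L := by
  obtain ⟨σ, hσ, hlock⟩ := exists_bc_locking hM hL
  -- The telltale is the content of a locking sequence. If H contains it and H ⊆ L, a text for H
  -- extending the sequence reaches a hypothesis correct for both H and L.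
  refine ⟨(σ.filterMap id).toFinset, fun x hx => hσ x (by simpa using hx), ?_⟩
  intro H hH hDH hHL
  obtain ⟨T, hT, hseg⟩ := exists_isText_extending (σ := σ) (L := H)
    fun x hx => hDH (by simpa using hx)
  obtain ⟨n, hn⟩ := hM H hH T hT
  obtain ⟨τ, hτ, hs⟩ := hseg n
  have h1 := hn (σ.length + n) (by omega)
  rw [hs] at h1
  exact h1.unique (hlock τ (hτ.mono hHL))

/-- Locking is applied to the event of an output not already produced on a prefix of σ. With
finitely many outputs on a text this event eventually stops, and E consists of the outputs on the
prefixes of σ. -/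
theorem exists_vac_locking {φ : ℕ → ℕ →. ℕ} {η : Setoid ℕ} {M : Learner} {C : Set (Set ℕ)}
    (hM : VacLearns φ η M C) {L : Set ℕ} (hL : L ∈ C) :
    ∃ σ, Over σ L ∧ ∃ E : List (Option ℕ), ∀ τ, Over τ L → M (σ ++ τ) ∈ E := by
  obtain ⟨σ, hσ, h⟩ := exists_locking L
    (fun σ ρ => M ρ ∉ (List.range (σ.length + 1)).map fun i => M (σ.take i)) fun T hT => by
    have hfin := hM.2 L hL T hT
    have hb : ∃ N, ∀ h ∈ {h : Option ℕ | ∃ n ≥ 1, h = M (seg T n)}, ∃ n ≤ N, h = M (seg T n) := by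
      choose! g hg hg' using fun (h : Option ℕ)
        (hh : h ∈ {h : Option ℕ | ∃ n ≥ 1, h = M (seg T n)}) => hh
      obtain ⟨N, hN⟩ := (hfin.image g).bddAbove
      exact ⟨N, fun h hh => ⟨g h, hN ⟨h, hh, rfl⟩, hg' h hh⟩⟩
    obtain ⟨N, hN⟩ := hb
    refine ⟨N + 1, fun m hm j hj => not_not.2 ?_⟩
    obtain ⟨n, hn, hMn⟩ := hN (M (seg T j)) ⟨j, by omega, rfl⟩
    refine List.mem_map.2 ⟨n, by simp; omega, ?_⟩
    rw [take_seg T (by omega), hMn]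
  exact ⟨σ, hσ, _, fun τ hτ => not_not.1 (h τ hτ)⟩

end Texts

/-! ### Learners from limit-computable parameters -/

section Learners

variable {φ : ℕ → ℕ →. ℕ} {η : Setoid ℕ}

theorem exists_index {α : Type*} [Primcodable α] (hφ : IsAcceptable φ) {G : α → Set ℕ}
    (hG : REPred fun p : α × ℕ => p.2 ∈ G p.1) :
    ∃ c : α → ℕ, Computable c ∧ ∀ a, W φ (c a) = G a := by
  classical
  have h1 : REPred fun p : ℕ × ℕ => ∃ a : α, Encodable.encode a = p.1 ∧ p.2 ∈ G a := by
    refine re_exists (p := fun q : (ℕ × ℕ) × α => Encodable.encode q.2 = q.1.1 ∧ q.1.2 ∈ G q.2)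
      (re_and (re_of_primrecPred' (Primrec.eq.comp (Primrec.encode.comp Primrec.snd)
        (Primrec.fst.comp Primrec.fst))) ?_)
    exact re_comp (f := fun q : (ℕ × ℕ) × α => (q.2, q.1.2)) hG
      (Computable.snd.pair (Computable.snd.comp Computable.fst))
  obtain ⟨c, hc, h⟩ := hφ.2 (fun e x => (Part.assert
    (∃ a : α, Encodable.encode a = e ∧ x ∈ G a) fun _ => Part.some ()).map fun _ => 0)
    (Partrec.map h1 (Computable.const 0).to₂)
  refine ⟨fun a => c (Encodable.encode a), hc.comp Computable.encode, fun a => ?_⟩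
  ext x
  rw [W, ← h]
  constructor
  · rintro ⟨⟨b, hb, hx⟩, -⟩
    exact Encodable.encode_injective hb ▸ hx
  · exact fun hx => ⟨⟨a, rfl, hx⟩, trivial⟩

theorem exLearnable_of_limit {α : Type*} [Primcodable α] (hφ : IsAcceptable φ) {G : α → Set ℕ}
    (hG : REPred fun p : α × ℕ => p.2 ∈ G p.1) {g : List (Option ℕ) → α} (hg : Computable g)
    {C : Set (Set ℕ)}
    (h : ∀ L ∈ C, ∀ T, IsText T L → ∃ a, etaClosure η (G a) = L ∧ ∃ n, ∀ m ≥ n, g (seg T m) = a) :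
    ExLearnable φ η C := by
  obtain ⟨c, hc, hW⟩ := exists_index hφ hG
  refine ⟨fun σ => some (c (g σ)), Computable.option_some.comp (hc.comp hg), fun L hL T hT => ?_⟩
  obtain ⟨a, ha, n, hn⟩ := h L hL T hT
  refine ⟨n, ⟨_, rfl, ?_⟩, fun j hj => ?_⟩
  · rw [hn n le_rfl, hW, ha]
  · dsimp only
    rw [hn n le_rfl, hn j hj]

theorem ExLearnable.vacLearnable {C : Set (Set ℕ)} (h : ExLearnable φ η C) :
    VacLearnable φ η C := by
  obtain ⟨M, hM, hL⟩ := h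
  refine ⟨M, hM, fun L hLC T hT => ?_, fun L hLC T hT => ?_⟩
  · obtain ⟨n, hn, hc⟩ := hL L hLC T hT
    exact ⟨n, fun j hj => (hc j hj).symm ▸ hn⟩
  · obtain ⟨n, -, hc⟩ := hL L hLC T hT
    refine ((Set.finite_Iic n).image fun i => M (seg T i)).subset ?_
    rintro _ ⟨m, -, rfl⟩
    rcases le_total m n with h | h
    · exact ⟨m, h, rfl⟩
    · exact ⟨n, le_refl n, (hc m h).symm⟩

theorem VacLearnable.bcLearnable {C : Set (Set ℕ)} (h : VacLearnable φ η C) :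
    BCLearnable φ η C :=
  let ⟨M, hM, hL⟩ := h
  ⟨M, hM, hL.1⟩

/-- The least index that is never refuted by a datum of the text is computable in the limit. -/
theorem exists_limit_least {V : (ℕ × Option ℕ) × ℕ → Prop} (hV : REPred V) :
    ∃ g : List (Option ℕ) → ℕ, Computable g ∧ ∀ (T : ℕ → Option ℕ) (n : ℕ),
      (∀ k < n, ∃ i, V ((i, T i), k)) → (∀ i, ¬ V ((i, T i), n)) →
        ∃ N, ∀ m ≥ N, g (seg T m) = n := by
  classical
  obtain ⟨v, hv, hVv⟩ := exists_primrecPred_of_re hV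
  let q : List (Option ℕ) → ℕ → Prop := fun σ n =>
    ∃ i ∈ List.range σ.length, ∃ s ∈ List.range σ.length, v (((i, σ.getD i none), n), s)
  have hq : PrimrecRel q := by
    have h1 : PrimrecRel fun (s : ℕ) (r : ℕ × List (Option ℕ) × ℕ) =>
        v (((r.1, r.2.1.getD r.1 none), r.2.2), s) :=
      hv.comp ((((Primrec.fst.comp Primrec.snd).pair
        ((Primrec.list_getD none).comp (Primrec.fst.comp (Primrec.snd.comp Primrec.snd))
          (Primrec.fst.comp Primrec.snd))).pair
        (Primrec.snd.comp (Primrec.snd.comp Primrec.snd))).pair Primrec.fst)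
    have h2 : PrimrecRel fun (i : ℕ) (r : List (Option ℕ) × ℕ) =>
        ∃ s ∈ List.range r.1.length, v (((i, r.1.getD i none), r.2), s) :=
      h1.exists_mem_list.comp (Primrec.list_range.comp
        (Primrec.list_length.comp (Primrec.fst.comp Primrec.snd))) Primrec.id
    exact h2.exists_mem_list.comp (Primrec.list_range.comp
        (Primrec.list_length.comp Primrec.fst)) Primrec.id
  refine ⟨fun σ => (List.range σ.length).findIdx fun n => decide (¬ q σ n), ?_, fun T n hn hn' => ?_⟩
  · have hd : Primrec₂ fun (σ : List (Option ℕ)) (n : ℕ) => decide (¬ q σ n) :=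
      PrimrecPred.decide (PrimrecPred.not hq)
    exact (Primrec.list_findIdx (Primrec.list_range.comp Primrec.list_length) hd).to_comp
  · have hqV : ∀ m k, q (seg T m) k → ∃ i, V ((i, T i), k) := by
      rintro m k ⟨i, hi, s, -, hs⟩
      refine ⟨i, (hVv _).2 ⟨s, ?_⟩⟩
      rwa [List.getD_eq_getElem?_getD, getElem?_seg (by simpa using hi)] at hs
    have hev : ∀ k < n, ∃ N, ∀ m ≥ N, q (seg T m) k := by
      intro k hk
      obtain ⟨i, hi⟩ := hn k hk
      obtain ⟨s, hs⟩ := (hVv _).1 hi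
      refine ⟨max i s + 1, fun m hm => ⟨i, by simp; omega, s, by simp; omega, ?_⟩⟩
      rwa [List.getD_eq_getElem?_getD, getElem?_seg (by omega)]
    choose! f hf using hev
    obtain ⟨N, hN⟩ := ((Set.finite_Iio n).image f).bddAbove
    refine ⟨max N (n + 1), fun m hm => ?_⟩
    rw [List.findIdx_eq (by simp; omega)]
    refine ⟨?_, fun j hj => ?_⟩
    · simp only [List.getElem_range, decide_eq_true_eq]
      exact fun h => let ⟨i, hi⟩ := hqV m n h; hn' i hi
    · simp only [List.getElem_range, decide_not, Bool.not_eq_false', decide_eq_true_eq]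
      exact hf j hj m ((hN ⟨j, hj, rfl⟩).trans (by omega))

theorem exists_limit_first_missing (hη : IsPositive η) {f : ℕ → ℕ} (hf : Computable f) :
    ∃ g : List (Option ℕ) → ℕ, Computable g ∧ ∀ (T : ℕ → Option ℕ) (L : Set ℕ) (n : ℕ),
      EtaClosed η L → IsText T L → (∀ k < n, f k ∈ L) → f n ∉ L →
        ∃ N, ∀ m ≥ N, g (seg T m) = n := by
  classical
  -- Index k is refuted by a datum equivalent to `f k`; such a datum occurs exactly when `f k ∈ L`,
  -- as L is η-closed.
  have hV : REPred fun p : (ℕ × Option ℕ) × ℕ => ∃ x, p.1.2 = some x ∧ η x (f p.2) := by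
    refine re_exists (p := fun q : ((ℕ × Option ℕ) × ℕ) × ℕ => q.1.1.2 = some q.2 ∧
      η q.2 (f q.1.2)) (re_and (re_of_primrecPred' (Primrec.eq.comp
        (Primrec.snd.comp (Primrec.fst.comp Primrec.fst))
        (Primrec.option_some.comp Primrec.snd))) ?_)
    exact re_eta hη Computable.snd (hf.comp (Computable.snd.comp Computable.fst))
  obtain ⟨g, hg, h⟩ := exists_limit_least hV
  refine ⟨g, hg, fun T L n hL hT hn hn' => h T n (fun k hk => ?_) ?_⟩
  · obtain ⟨i, hi⟩ := (hT _).1 (hn k hk)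
    exact ⟨i, f k, hi, η.refl _⟩
  · rintro i ⟨x, hi, hx⟩
    exact hn' (hL _ _ hx ((hT x).2 ⟨i, hi⟩))

theorem exLearnable_of_first_missing (hφ : IsAcceptable φ) (hη : IsPositive η) {f : ℕ → ℕ}
    (hf : Computable f) {G : ℕ → Set ℕ} (hG : REPred fun p : ℕ × ℕ => p.2 ∈ G p.1)
    {C : Set (Set ℕ)}
    (h : ∀ L ∈ C, EtaClosed η L ∧
      ∃ n, (∀ k < n, f k ∈ L) ∧ f n ∉ L ∧ etaClosure η (G n) = L) :
    ExLearnable φ η C := by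
  obtain ⟨g, hg, hlim⟩ := exists_limit_first_missing hη hf
  refine exLearnable_of_limit hφ hG hg fun L hL T hT => ?_
  obtain ⟨hLc, n, hn, hn', hGn⟩ := h L hL
  exact ⟨n, hGn, hlim T L n hLc hT hn hn'⟩

end Learners

/-! ### A proper r.e. η-infinite set: failure of union for all three criteria -/

section ProperInfinite

variable {φ : ℕ → ℕ →. ℕ} {η : Setoid ℕ}

theorem re_image_Iio {e : ℕ → ℕ} (he : Computable e) :
    REPred fun p : ℕ × ℕ => p.2 ∈ e '' Set.Iio p.1 := by
  have h1 : REPred fun q : ℕ × (ℕ × ℕ) => e q.1 = q.2.2 :=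
    (re_comp (f := fun q : ℕ × (ℕ × ℕ) => (e q.1, q.2.2)) (re_of_primrecPred' Primrec.eq)
      ((he.comp Computable.fst).pair (Computable.snd.comp Computable.snd)))
  refine (re_exists_mem (l := fun p : ℕ × ℕ => List.range p.1) h1
    (Primrec.list_range.comp Primrec.fst).to_comp).of_eq fun p => ?_
  simp

theorem isEtaFamily_range {B : ℕ → Set ℕ} (hB : REPred fun p : ℕ × ℕ => p.2 ∈ B p.1)
    (hinj : Function.Injective B) (hc : ∀ k, EtaClosed η (B k)) : IsEtaFamily η (Set.range B) :=
  ⟨B, hB, hinj, rfl, hc⟩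

theorem exists_exLearnable_not_bcLearnable_union (hφ : IsAcceptable φ) (hη : IsPositive η)
    {A : Set ℕ} (hA : REPred fun x : ℕ => x ∈ A) (hinf : EtaInfinite η A) (hne : A ≠ Set.univ) :
    ∃ L H : Set (Set ℕ), IsEtaFamily η L ∧ IsEtaFamily η H ∧ Disjoint L H ∧
      ExLearnable φ η L ∧ ExLearnable φ η H ∧ IsEtaFamily η (L ∪ H) ∧
      ¬ BCLearnable φ η (L ∪ H) := by
  obtain ⟨hAc, hAinf⟩ := hinf
  obtain ⟨e, he, rfl⟩ := exists_computable_range hA hAinf.nonempty.of_image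
  obtain ⟨d, hd⟩ := (Set.ne_univ_iff_exists_notMem _).1 hne
  have hdA : ∀ x ∈ Set.range e, ¬ η d x := fun x hx h => hd (hAc _ _ (η.symm h) hx)
  have hsub : ∀ k, chain η e k ⊆ Set.range e := chain_subset hAc fun n => ⟨n, rfl⟩
  have hchain_ne : ∀ k, chain η e k ≠ Set.range e := fun k h =>
    hAinf (h ▸ finite_chain k hAinf)
  -- The marker d lies outside A: within this family its absence identifies A, while the bare chain
  -- members of the other family lack it too.
  let B : ℕ → Set ℕ := fun k =>
    {x | (k = 0 ∧ x ∈ Set.range e) ∨ (k ≠ 0 ∧ (x ∈ chain η e (k - 1) ∨ η d x))}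
  have hB0 : B 0 = Set.range e := by ext x; simp [B]
  have hBs : ∀ k, B (k + 1) = chain η e k ∪ {x | η d x} := fun k => by ext x; simp [B]
  have hdc : EtaClosed η {x | η d x} := fun x y hxy hx => η.trans hx hxy
  have hBd : ∀ k, d ∈ B (k + 1) := fun k => by rw [hBs]; exact Or.inr (η.refl d)
  have hBsA : ∀ k, B (k + 1) ∩ Set.range e = chain η e k := by
    intro k
    rw [hBs]
    ext x
    constructor
    · rintro ⟨hx | hx, hxA⟩
      · exact hx
      · exact absurd hx (hdA x hxA)
    · exact fun hx => ⟨Or.inl hx, hsub k hx⟩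
  have hBc : ∀ k, EtaClosed η (B k) := by
    rintro (_ | k)
    · rw [hB0]; exact hAc
    · rw [hBs]; exact (etaClosed_chain k).union hdc
  have hre0 : REPred fun p : ℕ × ℕ => p.1 = 0 :=
    re_of_primrecPred' (Primrec.eq.comp Primrec.fst (Primrec.const 0))
  have hre1 : REPred fun p : ℕ × ℕ => p.1 ≠ 0 :=
    re_of_primrecPred' (PrimrecPred.not (Primrec.eq.comp Primrec.fst (Primrec.const 0)))
  have hpred : Computable fun p : ℕ × ℕ => (p.1 - 1, p.2) :=
    ((Primrec.pred.comp Primrec.fst).pair Primrec.snd).to_comp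
  have hred : REPred fun p : ℕ × ℕ => η d p.2 :=
    re_eta hη (Computable.const d) Computable.snd
  have hreA : REPred fun p : ℕ × ℕ => p.2 ∈ Set.range e := re_comp hA Computable.snd
  have hBre : REPred fun p : ℕ × ℕ => p.2 ∈ B p.1 :=
    re_or (re_and hre0 hreA) (re_and hre1 (re_or (re_comp (re_chain hη he) hpred) hred))
  have hBinj : Function.Injective B := by
    rintro (_ | k) (_ | l) h
    · rfl
    · exact absurd (h ▸ hBd l) (hB0 ▸ hd)
    · exact absurd (h ▸ hBd k) (hB0 ▸ hd)
    · have : chain η e k = chain η e l := by rw [← hBsA, ← hBsA, h]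
      rw [chain_injective hAinf this]
  have hL : IsEtaFamily η (Set.range (chain η e)) :=
    isEtaFamily_range (re_chain hη he) (chain_injective hAinf) etaClosed_chain
  have hH : IsEtaFamily η (Set.range B) := isEtaFamily_range hBre hBinj hBc
  have hdisj : Disjoint (Set.range (chain η e)) (Set.range B) := by
    rw [Set.disjoint_left]
    rintro _ ⟨k, rfl⟩ ⟨l | l, hl⟩
    · exact hchain_ne k (hl.symm.trans hB0)
    · exact hd (hsub k (hl ▸ hBd l))
  refine ⟨_, _, hL, hH, hdisj, ?_, ?_, hL.union hH hdisj, ?_⟩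
  · refine exLearnable_of_first_missing hφ hη he (G := fun n => e '' Set.Iio n)
      (re_image_Iio he) ?_
    rintro _ ⟨k, rfl⟩
    obtain ⟨n, h1, h2, h3, -⟩ := exists_chain_eq hAinf k
    exact ⟨etaClosed_chain k, n, h3, h2, h1.symm⟩
  -- Along d, e 0, e 1, …, the first missing index is 0 exactly for A; an index n + 1 calls for the
  -- first n terms of e together with d.
  · have hf : Computable fun n : ℕ => (Nat.casesOn n d e : ℕ) :=
      Computable.nat_casesOn Computable.id (Computable.const d) (he.comp Computable.snd).to₂
    have hG : REPred fun p : ℕ × ℕ => p.2 ∈ {x | (p.1 = 0 ∧ x ∈ Set.range e) ∨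
        (p.1 ≠ 0 ∧ (x ∈ e '' Set.Iio (p.1 - 1) ∨ η d x))} :=
      re_or (re_and hre0 hreA) (re_and hre1 (re_or (re_comp (re_image_Iio he) hpred) hred))
    refine exLearnable_of_first_missing hφ hη hf (G := fun n => {x | (n = 0 ∧ x ∈ Set.range e) ∨
        (n ≠ 0 ∧ (x ∈ e '' Set.Iio (n - 1) ∨ η d x))}) hG ?_
    rintro _ ⟨k | k, rfl⟩
    · refine ⟨hBc 0, 0, by simp, by rw [hB0]; exact hd, ?_⟩
      rw [hB0, ← hAc.etaClosure_eq]
      congr 1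
      ext x
      simp [hAc.etaClosure_eq]
    · obtain ⟨n, h1, h2, h3, -⟩ := exists_chain_eq hAinf k
      refine ⟨hBc _, n + 1, ?_, ?_, ?_⟩
      · rintro (_ | i) hi
        · exact hBd k
        · rw [hBs]
          exact Or.inl (h3 i (by omega))
      · rw [hBs]
        rintro (h | h)
        · exact h2 h
        · exact hdA _ ⟨n, rfl⟩ h
      · apply Set.Subset.antisymm
        · refine (hBc _).etaClosure_subset ?_
          rw [hBs]
          rintro x (⟨h, -⟩ | ⟨-, h | h⟩)
          · omega
          · exact Or.inl (h1 ▸ subset_etaClosure _ h)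
          · exact Or.inr h
        · rw [hBs, h1]
          rintro x (⟨y, hy, hyx⟩ | hx)
          · exact ⟨y, Or.inr ⟨by simp, Or.inl hy⟩, hyx⟩
          · exact ⟨d, Or.inr ⟨by simp, Or.inr (η.refl d)⟩, hx⟩
  · rintro ⟨M, -, hM⟩
    obtain ⟨D, hDA, hD⟩ := exists_telltale hM (L := Set.range e) (Or.inr ⟨0, hB0⟩)
    obtain ⟨k, hk⟩ : ∃ k, ↑D ⊆ chain η e k := by
      choose! g hg using fun x (hx : x ∈ D) => hDA hx
      obtain ⟨k, hk⟩ := (D.finite_toSet.image g).bddAbove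
      refine ⟨k, fun x hx => ?_⟩
      rw [← hg x hx]
      exact mem_chain (hk ⟨x, hx, rfl⟩)
    exact hchain_ne k (hD _ (Or.inl ⟨k, rfl⟩) hk (hsub k))

end ProperInfinite

/-! ### No proper r.e. η-infinite set: closure under union -/

section NoProperInfinite

variable {φ : ℕ → ℕ →. ℕ} {η : Setoid ℕ}

theorem univ_notMem_of_bcLearnable
    (h : ∀ A : Set ℕ, (REPred fun x : ℕ => x ∈ A) → EtaInfinite η A → A = Set.univ)
    {L : Set (Set ℕ)} (hL : IsEtaFamily η L) (hbc : BCLearnable φ η L) : Set.univ ∉ L := by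
  classical
  obtain ⟨B, hB, hinj, rfl, hc⟩ := hL
  obtain ⟨M, -, hM⟩ := hbc
  intro huniv
  obtain ⟨D, -, hD⟩ := exists_telltale hM huniv
  -- A telltale for ℕ would lie in only one member, whereas every finite set lies in infinitely
  -- many. In the induction step, if only finitely many members contained D ∪ {d}, the union U of
  -- the other members containing D would be r.e. and η-infinite, hence ℕ, and one of those members
  -- would contain d.
  have key : ∀ D : Finset ℕ, {i | ↑D ⊆ B i}.Infinite := by
    intro D
    induction D using Finset.induction_on with
    | empty => simpa using Set.infinite_univ
    | insert d D _ ih =>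
      intro hJ
      let U : Set ℕ := {x | ∃ i, (¬ ∃ j ∈ hJ.toFinset.toList, j = i) ∧
        (∀ b ∈ D.toList, b ∈ B i) ∧ x ∈ B i}
      have hre : REPred fun x : ℕ => x ∈ U := by
        refine re_exists (p := fun q : ℕ × ℕ => (¬ ∃ j ∈ hJ.toFinset.toList, j = q.2) ∧
          (∀ b ∈ D.toList, b ∈ B q.2) ∧ q.1 ∈ B q.2) (re_and ?_ (re_and ?_ ?_))
        · refine re_of_primrecPred' (PrimrecPred.not ?_)
          exact (PrimrecRel.exists_mem_list (R := fun c b : ℕ => c = b) Primrec.eq).comp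
            (Primrec.const _) Primrec.snd
        · exact re_forall_mem (p := fun r : ℕ × (ℕ × ℕ) => r.1 ∈ B r.2.2)
            (re_comp (f := fun r : ℕ × (ℕ × ℕ) => (r.2.2, r.1)) hB
              ((Computable.snd.comp Computable.snd).pair Computable.fst))
            (l := fun _ => D.toList) (Computable.const _)
        · exact re_comp (f := fun q : ℕ × ℕ => (q.2, q.1)) hB
            (Computable.snd.pair Computable.fst)
      have hUc : EtaClosed η U := by
        rintro x y hxy ⟨i, h1, h2, h3⟩
        exact ⟨i, h1, h2, hc i x y hxy h3⟩
      have hinfI : ({i | ↑D ⊆ B i} \ {i | ↑(insert d D) ⊆ B i}).Infinite := ih.sdiff hJ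
      -- A set with finitely many classes has only finitely many η-closed subsets.
      have hUinf : (Quotient.mk η '' U).Infinite := by
        intro hfin
        refine hinfI (Set.Finite.of_finite_image (f := fun i => Quotient.mk η '' B i)
          (hfin.finite_subsets.subset ?_) fun i _ j _ hij =>
            hinj ((hc i).eq_of_image_eq (hc j) hij))
        rintro _ ⟨i, ⟨hi, hi'⟩, rfl⟩
        refine Set.image_mono fun x hx => ⟨i, ?_, fun b hb => hi (by simpa using hb), hx⟩
        simpa using hi'
      have hdU : d ∈ U := h U hre ⟨hUc, hUinf⟩ ▸ Set.mem_univ d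
      obtain ⟨i, h1, h2, h3⟩ := hdU
      refine h1 ⟨i, ?_, rfl⟩
      simp only [Finset.mem_toList, Set.Finite.mem_toFinset, Set.mem_ofPred_eq]
      intro x hx
      rcases Finset.mem_insert.1 (Finset.mem_coe.1 hx) with rfl | hx
      · exact h3
      · exact h2 x (by simpa using hx)
  refine key D (Set.Subsingleton.finite fun i hi j hj => hinj ?_)
  rw [hD _ ⟨i, rfl⟩ hi (Set.subset_univ _), hD _ ⟨j, rfl⟩ hj (Set.subset_univ _)]

/-- The conjecture is the data seen so far. It is correct once each of the finitely many classes has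
been met, though its index may keep changing. -/
theorem bcLearnable_of_finite (hφ : IsAcceptable φ) {C : Set (Set ℕ)}
    (hC : ∀ L ∈ C, EtaClosed η L ∧ (Quotient.mk η '' L).Finite) : BCLearnable φ η C := by
  classical
  have hG : REPred fun p : List (Option ℕ) × ℕ => p.2 ∈ {x | some x ∈ p.1} := by
    have : PrimrecPred fun p : List (Option ℕ) × ℕ => ∃ o ∈ p.1, o = some p.2 :=
      (PrimrecRel.exists_mem_list (R := fun (o : Option ℕ) (x : ℕ) => o = some x)
        (Primrec.eq.comp Primrec.fst (Primrec.option_some.comp Primrec.snd))).comp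
        Primrec.fst Primrec.snd
    exact (re_of_primrecPred' this).of_eq fun p => by simp
  obtain ⟨c, hc, hW⟩ := exists_index hφ (G := fun σ : List (Option ℕ) => {x | some x ∈ σ}) hG
  refine ⟨fun σ => some (c σ), Computable.option_some.comp hc, fun L hL T hT => ?_⟩
  obtain ⟨hLc, hfin⟩ := hC L hL
  have hidx : ∀ q ∈ Quotient.mk η '' L, ∃ i x, T i = some x ∧ Quotient.mk η x = q := by
    rintro _ ⟨x, hx, rfl⟩
    obtain ⟨i, hi⟩ := (hT x).1 hx
    exact ⟨i, x, hi, rfl⟩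
  choose! g hg using hidx
  obtain ⟨N, hN⟩ := (hfin.image g).bddAbove
  refine ⟨N + 1, fun j hj => ⟨_, rfl, ?_⟩⟩
  rw [hW]
  apply Set.Subset.antisymm
  · refine hLc.etaClosure_subset fun x hx => ?_
    obtain ⟨i, -, hi⟩ := mem_seg.1 hx
    exact (hT x).2 ⟨i, hi⟩
  · intro y hy
    obtain ⟨x, hx, hxy⟩ := hg _ (Set.mem_image_of_mem _ hy)
    have := hN ⟨_, Set.mem_image_of_mem (Quotient.mk η) hy, rfl⟩
    exact ⟨x, mem_seg.2 ⟨_, by omega, hx⟩, Quotient.exact hxy⟩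

theorem closedUnderUnion_bcLearnable (hφ : IsAcceptable φ)
    (h : ∀ A : Set ℕ, (REPred fun x : ℕ => x ∈ A) → EtaInfinite η A → A = Set.univ) :
    ClosedUnderUnion η (BCLearnable φ η) := by
  have key : ∀ L, IsEtaFamily η L → BCLearnable φ η L →
      ∀ F ∈ L, EtaClosed η F ∧ (Quotient.mk η '' F).Finite := by
    intro L hL hbc F hF
    have huniv := univ_notMem_of_bcLearnable h hL hbc
    obtain ⟨B, hB, -, rfl, hc⟩ := hL
    obtain ⟨k, rfl⟩ := hF
    refine ⟨hc k, (not_etaInfinite_iff (hc k)).1 fun hinf => huniv ⟨k, ?_⟩⟩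
    exact h _ (re_comp (f := fun x : ℕ => (k, x)) hB
      ((Computable.const k).pair Computable.id)) hinf
  intro L H hL hH _ hLbc hHbc
  refine bcLearnable_of_finite hφ ?_
  rintro F (hF | hF)
  exacts [key L hL hLbc F hF, key H hH hHbc F hF]

end NoProperInfinite

/-! ### No proper r.e. η-infinite set: failure of union for explanatory and vacillatory learning -/

section Vacillatory

variable {φ : ℕ → ℕ →. ℕ} {η : Setoid ℕ}

theorem infinite_classes_range_id (hη : IsPositive η) :
    (Quotient.mk η '' Set.range id).Infinite := by
  rw [Set.range_id]
  exact (etaInfinite_univ hη).2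

/-- The union of the classes of `0` and `y`. -/
def zeroPair (η : Setoid ℕ) (y : ℕ) : Set ℕ := {x | η 0 x ∨ η y x}

/-- The union of the classes of `0` and `i + 1` as long as `i + 1` is the least element of its
class, and otherwise a member of the chain of initial unions of classes. -/
def pairOrChain (η : Setoid ℕ) (i : ℕ) : Set ℕ :=
  {x | x ∈ zeroPair η (i + 1) ∨
    ((∃ z ∈ List.range (i + 1), η z (i + 1)) ∧ x ∈ chain η id (2 * i + 3))}

theorem etaClosed_zeroPair (y : ℕ) : EtaClosed η (zeroPair η y) := by
  rintro a b hab (h | h)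
  exacts [Or.inl (η.trans h hab), Or.inr (η.trans h hab)]

theorem image_mk_zeroPair (y : ℕ) :
    Quotient.mk η '' zeroPair η y = {Quotient.mk η 0, Quotient.mk η y} := by
  apply Set.Subset.antisymm
  · rintro _ ⟨x, h | h, rfl⟩
    exacts [Or.inl (Quotient.sound h).symm, Or.inr (Quotient.sound h).symm]
  · rintro _ (rfl | rfl)
    exacts [⟨0, Or.inl (η.refl 0), rfl⟩, ⟨y, Or.inr (η.refl y), rfl⟩]

theorem ncard_zeroPair {y : ℕ} (h : ¬ η 0 y) : (Quotient.mk η '' zeroPair η y).ncard = 2 := by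
  rw [image_mk_zeroPair]
  exact Set.ncard_pair fun h' => h (Quotient.exact h')

theorem pairOrChain_cases (η : Setoid ℕ) (i : ℕ) :
    ((∀ z < i + 1, ¬ η z (i + 1)) ∧ pairOrChain η i = zeroPair η (i + 1)) ∨
      ((∃ z < i + 1, η z (i + 1)) ∧ pairOrChain η i = chain η id (2 * i + 3)) := by
  by_cases h : ∃ z < i + 1, η z (i + 1)
  · refine Or.inr ⟨h, ?_⟩
    -- The set enumerated as a pair can still grow into the chain member, since 0 and i + 1 are at
    -- most 2i + 3.
    have hsub : zeroPair η (i + 1) ⊆ chain η id (2 * i + 3) := by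
      rintro x (hx | hx)
      · exact etaClosed_chain _ _ _ hx (mem_chain (e := id) (Nat.zero_le _))
      · exact etaClosed_chain _ _ _ hx (mem_chain (e := id) (by omega))
    ext x
    constructor
    · rintro (hx | ⟨-, hx⟩)
      exacts [hsub hx, hx]
    · obtain ⟨z, hz, hzi⟩ := h
      exact fun hx => Or.inr ⟨⟨z, List.mem_range.2 hz, hzi⟩, hx⟩
  · refine Or.inl ⟨by simpa using h, ?_⟩
    ext x
    constructor
    · rintro (hx | ⟨⟨z, hz, hzi⟩, -⟩)
      · exact hx
      · exact absurd ⟨z, List.mem_range.1 hz, hzi⟩ h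
    · exact Or.inl

theorem etaClosed_pairOrChain (i : ℕ) : EtaClosed η (pairOrChain η i) := by
  rcases pairOrChain_cases η i with ⟨-, h⟩ | ⟨-, h⟩ <;> rw [h]
  exacts [etaClosed_zeroPair _, etaClosed_chain _]

theorem re_pairOrChain (hη : IsPositive η) :
    REPred fun p : ℕ × ℕ => p.2 ∈ pairOrChain η p.1 := by
  refine re_or (re_or ?_ ?_) (re_and ?_ ?_)
  · exact re_eta hη (Computable.const 0) Computable.snd
  · exact re_eta hη (f := fun p : ℕ × ℕ => p.1 + 1)
      (Computable.succ.comp Computable.fst) Computable.snd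
  · exact re_exists_mem (p := fun q : ℕ × (ℕ × ℕ) => η q.1 (q.2.1 + 1))
      (re_eta hη (g := fun q : ℕ × (ℕ × ℕ) => q.2.1 + 1) Computable.fst
        (Computable.succ.comp (Computable.fst.comp Computable.snd)))
      (l := fun p : ℕ × ℕ => List.range (p.1 + 1))
      (Primrec.list_range.comp (Primrec.succ.comp Primrec.fst)).to_comp
  · exact re_comp (f := fun p : ℕ × ℕ => (2 * p.1 + 3, p.2)) (re_chain hη Computable.id)
      ((Primrec.nat_add.comp (Primrec.nat_mul.comp (Primrec.const 2) Primrec.fst)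
        (Primrec.const 3)).pair Primrec.snd).to_comp

theorem ncard_chain_id (hη : IsPositive η) (k : ℕ) :
    (Quotient.mk η '' chain η id k).ncard = k + 1 := by
  obtain ⟨-, -, -, -, h⟩ := exists_chain_eq (infinite_classes_range_id hη) k
  exact h

/-- Pairs have 2 classes and chain members 2i + 4, so the types cannot collide; equal pairs share
the least element of their second class. -/
theorem injective_pairOrChain (hη : IsPositive η) : Function.Injective (pairOrChain η) := by
  intro i j h
  rcases pairOrChain_cases η i with ⟨hi, hi'⟩ | ⟨-, hi'⟩ <;>
    rcases pairOrChain_cases η j with ⟨hj, hj'⟩ | ⟨-, hj'⟩ <;> rw [hi', hj'] at h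
  · have h1 : i + 1 ∈ zeroPair η (j + 1) := h ▸ Or.inr (η.refl _)
    have h2 : j + 1 ∈ zeroPair η (i + 1) := h ▸ Or.inr (η.refl _)
    rcases lt_trichotomy i j with hlt | rfl | hlt
    · rcases h2 with h2 | h2
      exacts [absurd h2 (hj 0 (by omega)), absurd h2 (hj _ (by omega))]
    · rfl
    · rcases h1 with h1 | h1
      exacts [absurd h1 (hi 0 (by omega)), absurd h1 (hi _ (by omega))]
  · have h1 := ncard_zeroPair (hi 0 (by omega))
    rw [h, ncard_chain_id hη] at h1
    omega
  · have h1 := ncard_zeroPair (hj 0 (by omega))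
    rw [← h, ncard_chain_id hη] at h1
    omega
  · have := chain_injective (infinite_classes_range_id hη) h
    omega

theorem exLearnable_pairOrChain (hφ : IsAcceptable φ) (hη : IsPositive η) :
    ExLearnable φ η (Set.range (pairOrChain η)) := by
  classical
  obtain ⟨g, hg, hglim⟩ := exists_limit_first_missing hη Computable.id
  -- Position k is refuted when the text has there a pause or an element of [0]; the limit is the
  -- first position carrying another class.
  have hV : REPred fun p : (ℕ × Option ℕ) × ℕ =>
      p.1.1 = p.2 ∧ ∀ x ∈ p.1.2.toList, η x 0 := by
    refine re_and (re_of_primrecPred' (Primrec.eq.comp (Primrec.fst.comp Primrec.fst)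
      Primrec.snd)) ?_
    exact re_forall_mem (p := fun q : ℕ × ((ℕ × Option ℕ) × ℕ) => η q.1 0)
      (re_eta hη Computable.fst (Computable.const 0))
      (l := fun p : (ℕ × Option ℕ) × ℕ => p.1.2.toList)
      (primrec_option_toList.comp (Primrec.snd.comp Primrec.fst)).to_comp
  obtain ⟨g', hg', hglim'⟩ := exists_limit_least hV
  -- The parameter is the least number missing from L together with the first datum t outside [0].
  -- For a pair, 0 and t generate L; for a chain member, the numbers below the least missing one do,
  -- and t ∈ L is harmless.
  let G : ℕ × ℕ → Set ℕ := fun a => {x | x ∈ id '' Set.Iio a.1 ∨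
    ((Quotient.mk η '' (id '' Set.Iic (a.1 - 1))).ncard ≤ 2 ∧ x = a.2)}
  have hG : REPred fun p : (ℕ × ℕ) × ℕ => p.2 ∈ G p.1 := by
    refine re_or ?_ (re_and ?_ ?_)
    · exact re_comp (f := fun p : (ℕ × ℕ) × ℕ => (p.1.1, p.2)) (re_image_Iio Computable.id)
        ((Computable.fst.comp Computable.fst).pair Computable.snd)
    · exact re_comp (f := fun p : (ℕ × ℕ) × ℕ => (p.1.1 - 1, 2)) (re_ncard_le hη Computable.id)
        ((Primrec.pred.comp (Primrec.fst.comp Primrec.fst)).pair (Primrec.const 2)).to_comp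
    · exact re_of_primrecPred' (Primrec.eq.comp Primrec.snd (Primrec.snd.comp Primrec.fst))
  have hM : Computable fun σ : List (Option ℕ) => (g σ, (σ.getD (g' σ) none).getD 0) :=
    hg.pair (Computable.option_getD ((Primrec.list_getD none).to_comp.comp Computable.id hg')
      (Computable.const 0))
  refine exLearnable_of_limit hφ hG hM ?_
  rintro _ ⟨i, rfl⟩ T hT
  set L := pairOrChain η i with hLdef
  have hLc : EtaClosed η L := etaClosed_pairOrChain i
  have h0L : (0 : ℕ) ∈ L := Or.inl (Or.inl (η.refl 0))
  have hcard : 2 ≤ (Quotient.mk η '' L).ncard := by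
    rcases pairOrChain_cases η i with ⟨hi, hi'⟩ | ⟨-, hi'⟩ <;> rw [hLdef, hi']
    · rw [ncard_zeroPair (hi 0 (by omega))]
    · rw [ncard_chain_id hη]
      omega
  have hfin : (Quotient.mk η '' L).Finite := Set.finite_of_ncard_ne_zero (by omega)
  have hmiss : ∃ n, n ∉ L := by
    by_contra! hall
    exact (etaInfinite_univ hη).2 (Set.eq_univ_of_forall hall ▸ hfin)
  have hnon : ∃ j, ∃ x, T j = some x ∧ ¬ η x 0 := by
    obtain ⟨q, hq, hq0⟩ := Set.exists_ne_of_one_lt_ncard (s := Quotient.mk η '' L) (by omega)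
      (Quotient.mk η 0)
    obtain ⟨x, hx, rfl⟩ := hq
    obtain ⟨j, hj⟩ := (hT x).1 hx
    exact ⟨j, x, hj, fun h => hq0 (Quotient.sound h)⟩
  set n := Nat.find hmiss
  have hn : n ∉ L := Nat.find_spec hmiss
  have hn' : ∀ k < n, k ∈ L := fun k hk => not_not.1 (Nat.find_min hmiss hk)
  obtain ⟨N, hN⟩ := hglim T L n hLc hT hn' hn
  obtain ⟨t, ht, ht0⟩ := Nat.find_spec hnon
  obtain ⟨N', hN'⟩ := hglim' T (Nat.find hnon) (fun k hk => by
      refine ⟨k, rfl, fun x hx => ?_⟩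
      by_contra hcon
      exact Nat.find_min hnon hk ⟨x, by simpa using hx, hcon⟩) (by
      rintro j ⟨hj, hx⟩
      dsimp only at hj hx
      subst hj
      exact ht0 (hx t (by simp [ht])))
  have htL : t ∈ L := (hT t).2 ⟨_, ht⟩
  refine ⟨(n, t), ?_, max (max N N') (Nat.find hnon + 1), fun m hm => ?_⟩
  · apply Set.Subset.antisymm
    · refine hLc.etaClosure_subset ?_
      rintro x (⟨k, hk, rfl⟩ | ⟨-, rfl⟩)
      exacts [hn' k hk, htL]
    · rcases pairOrChain_cases η i with ⟨hi, hi'⟩ | ⟨-, hi'⟩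
      · have hn0 : n ≠ 0 := fun h => hn (h ▸ h0L)
        have hle : (Quotient.mk η '' (id '' Set.Iic (n - 1))).ncard ≤ 2 := by
          rw [← ncard_zeroPair (hi 0 (by omega)), ← hi']
          refine Set.ncard_le_ncard (Set.image_mono ?_) hfin
          rintro _ ⟨k, hk, rfl⟩
          simp only [Set.mem_Iic] at hk
          exact hn' k (by omega)
        have htp : t ∈ zeroPair η (i + 1) := hi' ▸ htL
        rw [hLdef, hi']
        rintro x (hx | hx)
        · exact ⟨0, Or.inl ⟨0, Nat.pos_of_ne_zero hn0, rfl⟩, hx⟩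
        · refine ⟨t, Or.inr ⟨hle, rfl⟩, ?_⟩
          rcases htp with h | h
          · exact absurd (η.symm h) ht0
          · exact η.trans (η.symm h) hx
      · obtain ⟨n', h1, h2, h3, -⟩ :=
          exists_chain_eq (infinite_classes_range_id hη) (2 * i + 3)
        rw [← hi', ← hLdef] at h1 h2 h3
        have hnn : n' = n := by
          rcases lt_trichotomy n' n with h | h | h
          · exact absurd (hn' n' h) h2
          · exact h
          · exact absurd (h3 n h) hn
        rw [h1, hnn]
        rintro x ⟨y, hy, hyx⟩
        exact ⟨y, Or.inl hy, hyx⟩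
  · rw [hN m (by omega), hN' m (by omega), List.getD_eq_getElem?_getD, getElem?_seg (by omega), ht]
    rfl

theorem chain_zero (hη : IsPositive η) : chain η id 0 = {x | η 0 x} := by
  have h0 : (0 : ℕ) ∈ chain η id 0 := mem_chain (e := id) le_rfl
  obtain ⟨q, hq⟩ := Set.ncard_eq_one.1 (ncard_chain_id hη 0)
  ext x
  constructor
  · intro hx
    have h1 : Quotient.mk η 0 ∈ ({q} : Set _) := hq ▸ Set.mem_image_of_mem _ h0
    have h2 : Quotient.mk η x ∈ ({q} : Set _) := hq ▸ Set.mem_image_of_mem _ hx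
    exact Quotient.exact (h1.trans h2.symm)
  · exact fun hx => etaClosed_chain _ _ _ hx h0

/-- The index comes from the least element of the class of y, which is positive because y is not
equivalent to 0. -/
theorem exists_pairOrChain_eq {y : ℕ} (hy : ¬ η 0 y) : ∃ i, pairOrChain η i = zeroPair η y := by
  classical
  have hex : ∃ z, η z y := ⟨y, η.refl y⟩
  have hspec := Nat.find_spec hex
  have hmin : ∀ z < Nat.find hex, ¬ η z y := fun z hz => Nat.find_min hex hz
  rcases hz : Nat.find hex with _ | i
  · exact absurd (hz ▸ hspec) hy
  · rw [hz] at hspec hmin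
    refine ⟨i, ?_⟩
    rcases pairOrChain_cases η i with ⟨-, h⟩ | ⟨⟨z, hz, hzi⟩, -⟩
    · rw [h]
      ext x
      exact or_congr_right ⟨fun hx => η.trans (η.symm hspec) hx, fun hx => η.trans hspec hx⟩
    · exact absurd (η.trans hzi hspec) (hmin z hz)

/-- A class containing the class of `0` and all its unions with one more class is not
vacillatorily learnable unless the class of `0` is recursive. -/
theorem not_vacLearnable_of_zeroPair (hη : IsPositive η)
    (h : ∀ A : Set ℕ, (REPred fun x : ℕ => x ∈ A) → EtaInfinite η A → A = Set.univ)
    {C : Set (Set ℕ)} (h0 : {x | η 0 x} ∈ C) (hC : ∀ y, ¬ η 0 y → zeroPair η y ∈ C) :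
    ¬ VacLearnable φ η C := by
  classical
  rintro ⟨M, hMc, hM⟩
  obtain ⟨σ, hσ, E, hE⟩ := exists_vac_locking hM h0
  -- U collects the y for which some data from [{0, y}] after σ drive M out of E. For y = 0 the
  -- locking property forbids this.
  let U : Set ℕ := {y | ∃ τ : List (Option ℕ),
    (∀ o ∈ τ, ∀ x ∈ o.toList, x ∈ zeroPair η y) ∧ ¬ ∃ o ∈ E, o = M (σ ++ τ)}
  have hover : ∀ (τ : List (Option ℕ)) (y : ℕ),
      (∀ o ∈ τ, ∀ x ∈ o.toList, x ∈ zeroPair η y) ↔ Over τ (zeroPair η y) := by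
    intro τ y
    constructor
    · exact fun hτ x hx => hτ _ hx x (by simp)
    · intro hτ o ho x hx
      exact hτ x (by simpa [Option.mem_toList.1 hx] using ho)
  have hre : REPred fun y : ℕ => y ∈ U := by
    refine re_exists (p := fun q : ℕ × List (Option ℕ) =>
      (∀ o ∈ q.2, ∀ x ∈ o.toList, x ∈ zeroPair η q.1) ∧ ¬ ∃ o ∈ E, o = M (σ ++ q.2))
      (re_and ?_ ?_)
    · have h1 : REPred fun q : ℕ × (Option ℕ × ℕ) => q.1 ∈ zeroPair η q.2.2 :=
        re_or (re_eta hη (Computable.const 0) Computable.fst)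
          (re_eta hη (f := fun q : ℕ × (Option ℕ × ℕ) => q.2.2)
            (Computable.snd.comp Computable.snd) Computable.fst)
      have h2 : REPred fun q : Option ℕ × ℕ => ∀ x ∈ q.1.toList, x ∈ zeroPair η q.2 :=
        re_forall_mem (p := fun q : ℕ × (Option ℕ × ℕ) => q.1 ∈ zeroPair η q.2.2) h1
          (l := fun q : Option ℕ × ℕ => q.1.toList) (primrec_option_toList.comp Primrec.fst).to_comp
      exact re_forall_mem (p := fun r : Option ℕ × (ℕ × List (Option ℕ)) =>
          ∀ x ∈ r.1.toList, x ∈ zeroPair η r.2.1)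
        (re_comp (f := fun r : Option ℕ × (ℕ × List (Option ℕ)) => (r.1, r.2.1)) h2
          (Computable.fst.pair (Computable.fst.comp Computable.snd)))
        (l := fun q : ℕ × List (Option ℕ) => q.2) Computable.snd
    · have h1 : PrimrecPred fun o : Option ℕ => ¬ ∃ o' ∈ E, o' = o :=
        PrimrecPred.not ((PrimrecRel.exists_mem_list (R := fun a b : Option ℕ => a = b)
          Primrec.eq).comp (Primrec.const E) Primrec.id)
      exact re_comp (f := fun q : ℕ × List (Option ℕ) => M (σ ++ q.2)) (re_of_primrecPred' h1)
        (hMc.comp (Computable.list_append.comp (Computable.const σ) Computable.snd))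
  have hpair : ∀ x y, η x y → zeroPair η x = zeroPair η y := fun x y hxy => by
    ext z
    exact or_congr_right ⟨fun hz => η.trans (η.symm hxy) hz, fun hz => η.trans hxy hz⟩
  have hUc : EtaClosed η U := by
    rintro x y hxy ⟨τ, hτ, hMτ⟩
    exact ⟨τ, by rwa [← hpair x y hxy], hMτ⟩
  have h0U : (0 : ℕ) ∉ U := by
    rintro ⟨τ, hτ, hMτ⟩
    refine hMτ ⟨_, hE τ ?_, rfl⟩
    refine ((hover τ 0).1 hτ).mono ?_
    rintro x (hx | hx) <;> exact hx
  have hcorrect : ∀ y, ¬ η 0 y → y ∉ U → ∃ o ∈ E, Correct φ η o (zeroPair η y) := by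
    intro y hy hyU
    obtain ⟨T, hT, hseg⟩ := exists_isText_extending (hσ.mono (H := zeroPair η y) fun x => Or.inl)
    obtain ⟨n, hn⟩ := hM.1 _ (hC y hy) T hT
    obtain ⟨τ, hτ, hs⟩ := hseg n
    have h1 := hn (σ.length + n) (by omega)
    rw [hs] at h1
    refine ⟨M (σ ++ τ), ?_, h1⟩
    by_contra hcon
    exact hyU ⟨τ, (hover τ y).2 hτ, fun ⟨o, ho, ho'⟩ => hcon (ho' ▸ ho)⟩
  -- Outside U and [0], some member of E is correct for [{0, y}]. Each hypothesis is correct for at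
  -- most one set, so only finitely many classes lie outside U.
  have hUinf : (Quotient.mk η '' U).Infinite := by
    intro hfin
    let R : Option ℕ → Set (Quotient η) := fun o =>
      {q | ∃ y, Quotient.mk η y = q ∧ ¬ η 0 y ∧ Correct φ η o (zeroPair η y)}
    have hR : ∀ o, (R o).Finite := fun o => Set.Subsingleton.finite <| by
      rintro _ ⟨y, rfl, hy, hyo⟩ _ ⟨z, rfl, hz, hzo⟩
      have : y ∈ zeroPair η z := hyo.unique hzo ▸ Or.inr (η.refl y)
      rcases this with h' | h'
      · exact absurd h' hy
      · exact (Quotient.sound h').symm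
    have hE' : (⋃ o ∈ {o | o ∈ E}, R o).Finite :=
      Set.Finite.biUnion (List.finite_toSet E) fun o _ => hR o
    refine (etaInfinite_univ hη).2 (((hfin.union hE').insert (Quotient.mk η 0)).subset ?_)
    rintro _ ⟨y, -, rfl⟩
    by_cases hy : η 0 y
    · exact Or.inl (Quotient.sound hy).symm
    by_cases hyU : y ∈ U
    · exact Or.inr (Or.inl (Set.mem_image_of_mem _ hyU))
    · obtain ⟨o, ho, hc⟩ := hcorrect y hy hyU
      exact Or.inr (Or.inr (Set.mem_biUnion (x := o) ho ⟨y, rfl, hy, hc⟩))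
  exact h0U (h U hre ⟨hUc, hUinf⟩ ▸ Set.mem_univ 0)

theorem exists_exLearnable_not_vacLearnable_union (hφ : IsAcceptable φ) (hη : IsPositive η)
    (h : ∀ A : Set ℕ, (REPred fun x : ℕ => x ∈ A) → EtaInfinite η A → A = Set.univ) :
    ∃ L H : Set (Set ℕ), IsEtaFamily η L ∧ IsEtaFamily η H ∧ Disjoint L H ∧
      ExLearnable φ η L ∧ ExLearnable φ η H ∧ IsEtaFamily η (L ∪ H) ∧
      ¬ VacLearnable φ η (L ∪ H) := by
  have hinf := infinite_classes_range_id hη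
  have hL : IsEtaFamily η (Set.range fun k => chain η id (2 * k)) := by
    refine isEtaFamily_range ?_ (fun i j hij => ?_) fun k => etaClosed_chain _
    · exact re_comp (f := fun p : ℕ × ℕ => (2 * p.1, p.2)) (re_chain hη Computable.id)
        ((Primrec.nat_mul.comp (Primrec.const 2) Primrec.fst).pair Primrec.snd).to_comp
    · have := chain_injective hinf hij
      omega
  have hH : IsEtaFamily η (Set.range (pairOrChain η)) :=
    isEtaFamily_range (re_pairOrChain hη) (injective_pairOrChain hη) etaClosed_pairOrChain
  -- Members of the first family have an odd number of classes, those of the second an even number.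
  have hdisj : Disjoint (Set.range fun k => chain η id (2 * k)) (Set.range (pairOrChain η)) := by
    rw [Set.disjoint_left]
    rintro _ ⟨k, rfl⟩ ⟨i, hi⟩
    have hk := ncard_chain_id hη (2 * k)
    rw [← show pairOrChain η i = chain η id (2 * k) from hi] at hk
    rcases pairOrChain_cases η i with ⟨hm, h'⟩ | ⟨-, h'⟩ <;> rw [h'] at hk
    · rw [ncard_zeroPair (hm 0 (by omega))] at hk
      omega
    · rw [ncard_chain_id hη] at hk
      omega
  refine ⟨_, _, hL, hH, hdisj, ?_, exLearnable_pairOrChain hφ hη, hL.union hH hdisj, ?_⟩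
  · refine exLearnable_of_first_missing hφ hη Computable.id
      (G := fun n => id '' Set.Iio n) (re_image_Iio Computable.id) ?_
    rintro _ ⟨k, rfl⟩
    obtain ⟨n, h1, h2, h3, -⟩ := exists_chain_eq hinf (2 * k)
    exact ⟨etaClosed_chain _, n, h3, h2, h1.symm⟩
  · refine not_vacLearnable_of_zeroPair hη h (Or.inl ⟨0, chain_zero hη⟩) fun y hy => ?_
    obtain ⟨i, hi⟩ := exists_pairOrChain_eq hy
    exact Or.inr ⟨i, hi⟩

end Vacillatory

end EtaLearning

theorem theorem5p2 (φ : ℕ → ℕ →. ℕ) (hφ : EtaLearning.IsAcceptable φ)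
    (η : Setoid ℕ) (hη : EtaLearning.IsPositive η) :
    (∃ L₁ L₂ : Set (Set ℕ),
      EtaLearning.IsEtaFamily η L₁ ∧ EtaLearning.IsEtaFamily η L₂ ∧ Disjoint L₁ L₂ ∧
      EtaLearning.ExLearnable φ η L₁ ∧ EtaLearning.ExLearnable φ η L₂ ∧
      EtaLearning.IsEtaFamily η (L₁ ∪ L₂) ∧ ¬ EtaLearning.ExLearnable φ η (L₁ ∪ L₂)) ∧
    (∃ L₁ L₂ : Set (Set ℕ),
      EtaLearning.IsEtaFamily η L₁ ∧ EtaLearning.IsEtaFamily η L₂ ∧ Disjoint L₁ L₂ ∧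
      EtaLearning.VacLearnable φ η L₁ ∧ EtaLearning.VacLearnable φ η L₂ ∧
      EtaLearning.IsEtaFamily η (L₁ ∪ L₂) ∧ ¬ EtaLearning.VacLearnable φ η (L₁ ∪ L₂)) ∧
    (EtaLearning.ClosedUnderUnion η (EtaLearning.BCLearnable φ η) ↔
      ∀ A : Set ℕ, (REPred (fun x : ℕ => x ∈ A) ∧ EtaLearning.EtaInfinite η A) ↔
        A = Set.univ) := by
  have huniv : REPred fun x : ℕ => x ∈ (Set.univ : Set ℕ) :=
    (EtaLearning.re_of_computable_bool (Computable.const true)).of_eq fun x => by simp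
  by_cases h : ∀ A : Set ℕ, (REPred fun x : ℕ => x ∈ A) → EtaLearning.EtaInfinite η A →
      A = Set.univ
  · obtain ⟨L, H, hL, hH, hd, hLe, hHe, hU, hn⟩ :=
      EtaLearning.exists_exLearnable_not_vacLearnable_union hφ hη h
    refine ⟨⟨L, H, hL, hH, hd, hLe, hHe, hU, fun he => hn he.vacLearnable⟩,
      ⟨L, H, hL, hH, hd, hLe.vacLearnable, hHe.vacLearnable, hU, hn⟩, fun _ A =>
        ⟨fun hA => h A hA.1 hA.2, ?_⟩, fun _ => EtaLearning.closedUnderUnion_bcLearnable hφ h⟩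
    rintro rfl
    exact ⟨huniv, EtaLearning.etaInfinite_univ hη⟩
  · push Not at h
    obtain ⟨A, hA, hinf, hne⟩ := h
    obtain ⟨L, H, hL, hH, hd, hLe, hHe, hU, hn⟩ :=
      EtaLearning.exists_exLearnable_not_bcLearnable_union hφ hη hA hinf hne
    refine ⟨⟨L, H, hL, hH, hd, hLe, hHe, hU, fun he => hn he.vacLearnable.bcLearnable⟩,
      ⟨L, H, hL, hH, hd, hLe.vacLearnable, hHe.vacLearnable, hU, fun he => hn he.bcLearnable⟩,
      fun hc => ?_, fun hall => absurd ((hall A).1 ⟨hA, hinf⟩) hne⟩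
    exact absurd (hc L H hL hH hU hLe.vacLearnable.bcLearnable hHe.vacLearnable.bcLearnable) hn
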